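/- Let $d\ge 4$ be an even integer, $1<k<d$, and let $\Omega=\begin{pmatrix}0&I_{d/2}\\-I_{d/2}&0\end{pmatrix}$. For $p,q\in\mathbb{R}$ let $$\mathcal{L}_{p,q}(Z)=\frac{1-p-q}{d}\operatorname{Tr}(Z)\,I_d+pZ+q\,\Omega Z^{\top}\Omega^{*},\qquad Z\in M_d(\mathbb{C}),$$ and let $\mathbb{P}_k\subset\mathbb{R}^2$ be the set of $(p,q)$ for which $\mathcal{L}_{p,q}$ is $k$-positive, i.e. $\mathrm{id}_k\otimes\mathcal{L}_{p,q}$ maps positive semidefinite matrices in $M_k(\mathbb{C})\otimes M_d(\mathbb{C})$ to positive semidefinite matrices. For real $u\ge 0$ put $$f_u^{(d,k)}(x,y)=\bigl(1-x-(1+d)y\bigr)\bigl(1-(1-kd)x-y\bigr)+d^2u\,xy .$$ Let $$A=(1,0),\quad B=\Bigl(0,\tfrac1{d+1}\Bigr),\quad C=\Bigl(\tfrac{-1}{kd-1},0\Bigr),\quad D=\Bigl(\tfrac{-1}{kd-k-1},\tfrac{-k}{kd-k-1}\Bigr),\quad E=\Bigl(\tfrac{-2}{d^2-d-2},\tfrac{-d}{d^2-d-2}\Bigr),$$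 and write $[X,Y]$ for the closed line segment from $X$ to $Y$. 1. If $k\le d/2$ and $k$ is even, then $(p,q)\in\mathbb{P}_k$ if and only if $$p+(1+d)q\le 1,\quad (1-kd)p+(1+d)q\le 1,\quad (1-kd)p+q\le 1,\quad p+(1-d)q\le 1 .$$ The set of extreme points of $\mathbb{P}_k$ is $\{A,B,C,D\}$, and the boundary of $\mathbb{P}_k$ is $[A,B]\cup[B,C]\cup[C,D]\cup[D,A]$. 2. If $k\le d/2$ and $k$ is odd, then $(p,q)\in\mathbb{P}_k$ if and only if $$p+(1+d)q\le 1,\quad f^{(d,k)}_{k-1}(p,q)\ge 0,\quad (1-kd)p+q\le 1,\quad p+(1-d)q\le 1 .$$ The curve $f^{(d,k)}_{k-1}=0$ is a nondegenerate hyperbola, containing an arc $\Gamma_1$ from $B$ to $C$ such that the boundary of $\mathbb{P}_k$ is $[A,B]\cup\Gamma_1\cup[C,D]\cup[D,A]$ and the set of extreme points of $\mathbb{P}_k$ is $\{A,B,C,D\}\cup\Gamma_1$. 3. If $d/2<k$ and $k$ is even, then $(p,q)\in\mathbb{P}_k$ if and only if $$p+(1+d)q\le 1,\quad (1-kd)p+(1+d)q\le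 1,\quad f^{(d,k)}_{2k-d}(p,q)\ge 0,\quad p+(1-d)q\le 1 .$$ The curve $f^{(d,k)}_{2k-d}=0$ is a nondegenerate hyperbola, containing an arc $\Gamma_2$ from $C$ to $E$ such that the boundary of $\mathbb{P}_k$ is $[A,B]\cup[B,C]\cup\Gamma_2\cup[E,A]$ and the set of extreme points of $\mathbb{P}_k$ is $\{A,B,C,E\}\cup\Gamma_2$. 4. If $d/2<k$ and $k$ is odd, then $(p,q)\in\mathbb{P}_k$ if and only if $$p+(1+d)q\le 1,\quad f^{(d,k)}_{k-1}(p,q)\ge 0,\quad f^{(d,k)}_{2k-d}(p,q)\ge 0,\quad p+(1-d)q\le 1 .$$ The curves $f^{(d,k)}_{k-1}=0$ and $f^{(d,k)}_{2k-d}=0$ are nondegenerate hyperbolas, containing arcs $\Gamma_1$ from $B$ to $C$ and $\Gamma_2$ from $C$ to $E$, respectively, such that the boundary of $\mathbb{P}_k$ is $[A,B]\cup\Gamma_1\cup\Gamma_2\cup[E,A]$ and the set of extreme points of $\mathbb{P}_k$ is $\{A,B,C,E\}\cup\Gamma_1\cup\Gamma_2$. 5. If $d/2<k$, the curves $f^{(d,k)}_{k-1}=0$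 and $f^{(d,k)}_{2k-d}=0$ coincide if and only if $k=d-1$. -/

import Mathlib

open scoped ComplexOrder

noncomputable section

/-- The `d × d` matrix with block form `(0, I; -I, 0)`, blocks of size `d / 2` (for even `d`). -/
def omegaMatrix (d : ℕ) : Matrix (Fin d) (Fin d) ℂ :=
  Matrix.of fun i j =>
    if (j : ℕ) = i + d / 2 then 1 else if (i : ℕ) = j + d / 2 then -1 else 0

/-- The linear map `Z ↦ (1 - p - q) Tr(Z) I / d + p Z + q Ω Zᵀ Ω*` on `d × d` complex matrices. -/
def sympMap (d : ℕ) (p q : ℝ) : Matrix (Fin d) (Fin d) ℂ →ₗ[ℂ] Matrix (Fin d) (Fin d) ℂ where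
  toFun Z := (((1 - p - q : ℝ) : ℂ) * (Z.trace / (d : ℂ))) • (1 : Matrix (Fin d) (Fin d) ℂ)
    + (p : ℂ) • Z + (q : ℂ) • (omegaMatrix d * Z.transpose * (omegaMatrix d).conjTranspose)
  map_add' X Y := by
    simp only [Matrix.trace_add, Matrix.transpose_add, Matrix.add_mul, smul_add,
      add_div, mul_add, add_smul]
    abel
  map_smul' c X := by
    simp only [Matrix.trace_smul, Matrix.transpose_smul, Matrix.mul_smul, Matrix.smul_mul,
      smul_add, smul_smul, smul_eq_mul, RingHom.id_apply, mul_comm c]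
    congr 3
    ring

/-- The ampliation `id_k ⊗ L`: a `k × k` block matrix is mapped by applying `L` to each block. -/
def ampliation (k : ℕ) {m n : Type*}
    (L : Matrix m m ℂ →ₗ[ℂ] Matrix n n ℂ) (X : Matrix (Fin k × m) (Fin k × m) ℂ) :
    Matrix (Fin k × n) (Fin k × n) ℂ :=
  Matrix.of fun a b => L (Matrix.of fun i j => X (a.1, i) (b.1, j)) a.2 b.2

/-- `L` is `k`-positive: `id_k ⊗ L` preserves positive semidefiniteness. -/
def IsKPositive (k : ℕ) {m n : Type*}
    (L : Matrix m m ℂ →ₗ[ℂ] Matrix n n ℂ) : Prop :=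
  ∀ X : Matrix (Fin k × m) (Fin k × m) ℂ, X.PosSemidef → (ampliation k L X).PosSemidef

/-- The set of all `(p, q)` for which `sympMap d p q` is `k`-positive. -/
def kPosRegion (d k : ℕ) : Set (ℝ × ℝ) :=
  {z | IsKPositive k (sympMap d z.1 z.2)}

/-- The quadratic polynomial `f_u^{(d,k)}(x, y)`. -/
def fQuad (d k : ℕ) (u x y : ℝ) : ℝ :=
  (1 - x - (1 + (d : ℝ)) * y) * (1 - (1 - (k : ℝ) * d) * x - y) + (d : ℝ) ^ 2 * u * x * y

/-- The conic `f_u^{(d,k)} = 0`. -/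
def fCurve (d k : ℕ) (u : ℝ) : Set (ℝ × ℝ) :=
  {z | fQuad d k u z.1 z.2 = 0}

/-- A (nondegenerate) hyperbola: the zero set of `a x² + b x y + c y² + e x + g y + h` with
positive discriminant `b² - 4 a c` and nonzero determinant of the associated ternary form. -/
def IsHyperbola (S : Set (ℝ × ℝ)) : Prop :=
  ∃ a b c e g h : ℝ,
    S = {z | a * z.1 ^ 2 + b * z.1 * z.2 + c * z.2 ^ 2 + e * z.1 + g * z.2 + h = 0} ∧
    0 < b ^ 2 - 4 * a * c ∧
    Matrix.det !![a, b / 2, e / 2; b / 2, c, g / 2; e / 2, g / 2, h] ≠ 0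

/-- `C` is a simple arc with end points `P`, `Q` contained in the curve `S`. (If `S` is a
hyperbola, there is at most one such `C`, the piece of a branch between `P` and `Q`.) -/
def IsArcOf (S : Set (ℝ × ℝ)) (P Q : ℝ × ℝ) (C : Set (ℝ × ℝ)) : Prop :=
  C ⊆ S ∧ ∃ γ : Path P Q, Function.Injective γ ∧ Set.range γ = C

/-- The point `(1, 0)`. -/
def vtxA : ℝ × ℝ := (1, 0)

/-- The point `(0, 1 / (d + 1))`. -/
def vtxB (d : ℕ) : ℝ × ℝ := (0, 1 / ((d : ℝ) + 1))

/-- The point `(-1 / (k d - 1), 0)`. -/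
def vtxC (d k : ℕ) : ℝ × ℝ := (-1 / ((k : ℝ) * d - 1), 0)

/-- The point `(-1 / (k d - k - 1), -k / (k d - k - 1))`. -/
def vtxD (d k : ℕ) : ℝ × ℝ :=
  (-1 / ((k : ℝ) * d - k - 1), -(k : ℝ) / ((k : ℝ) * d - k - 1))

/-- The point `(-2 / (d² - d - 2), -d / (d² - d - 2))`. -/
def vtxE (d : ℕ) : ℝ × ℝ :=
  (-2 / ((d : ℝ) ^ 2 - d - 2), -(d : ℝ) / ((d : ℝ) ^ 2 - d - 2))

end

open Matrix

/-! A positive semidefinite matrix is a sum of rank-one ones, so `k`-positivity says that the form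
`sympForm` is nonnegative at every `X` of rank at most `k` (`isKPositive_sympMap_iff`). Put a = (1 -
p - q)/d. Write X = M U* with U an isometry and split M along E = Ω conj(U). The form becomes a(σ +
α + m) + p t² + q(σ - α), where σ and α measure the symmetric and antisymmetric parts of L = E*M, m
measures the part of M orthogonal to E, and t = |Tr X|. Since U*E is antisymmetric, t is bounded
through α and m alone, by Cauchy-Schwarz with the single parameter s = ‖U*E‖²
(`sympForm_mul_conjTranspose_eq`). Here max(0, 2k - d) ≤ s ≤ k, and s ≤ k - 1 for odd k because an
antisymmetric matrix of odd size is singular.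

For p < 0 the form is nonnegative once a + q ≥ 0, a - q > 0 and `conic` is nonnegative at s. As
`conic` is affine in s, only the two extreme values r and R of s matter, and diagonal test matrices
show that both are needed (`IsKPositive.projForm_nonneg`). Hence the region is `projRegion`, an
intersection of half-planes, because `projForm` is affine in (p, q) for fixed c, e.

The conics are parametrized by t = q/a (`hypPoint`), and the half-plane of `projForm` with (c, e) =
(1, 1 - t) supports the region at parameter t. For p < 0 the conic of R bounds the part q ≥ 0 (from
B to C) and the conic of r the part q ≤ 0 (from C to D or E). For u = k or u = 0 the conic splits
into two lines and the arc is a segment; for 0 < u < k every point of the arc is extreme. -/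

/-! ### Reduction of `k`-positivity to a form on matrices of rank at most `k`. -/

/-- The Hermitian form of the Choi matrix of `sympMap d p q`, evaluated at a `d × d` matrix. -/
noncomputable def sympForm {d : ℕ} (p q : ℝ) (X : Matrix (Fin d) (Fin d) ℂ) : ℂ :=
  ((1 - p - q : ℝ) : ℂ) / d * (Xᴴ * X).trace + p * (star X.trace * X.trace)
    + q * (Xᴴ * omegaMatrix d * Xᵀ * omegaMatrix d).trace

lemma omegaMatrix_transpose {d : ℕ} (hd : 2 ≤ d) : (omegaMatrix d)ᵀ = -omegaMatrix d := by
  ext i j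
  have : 0 < d / 2 := by omega
  rw [neg_apply, transpose_apply]
  simp only [omegaMatrix, of_apply]
  split_ifs <;> first | omega | simp

lemma omegaMatrix_conjTranspose {d : ℕ} (hd : 2 ≤ d) : (omegaMatrix d)ᴴ = -omegaMatrix d := by
  rw [← omegaMatrix_transpose hd]
  ext i j
  simp only [omegaMatrix, transpose_apply, of_apply, conjTranspose_apply]
  split_ifs <;> simp

lemma sum_mul_eq_trace_mul_transpose {k : ℕ} (A B : Matrix (Fin k) (Fin k) ℂ) :
    ∑ i, ∑ j, A i j * B i j = (A * Bᵀ).trace := by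
  simp [trace, mul_apply]

lemma sympMap_vecMulVec_form {d : ℕ} (p q : ℝ) (v v' w w' : Fin d → ℂ) :
    star w ⬝ᵥ (sympMap d p q (vecMulVec v (star v')) *ᵥ w') =
      ((1 - p - q : ℝ) : ℂ) / d * ((star v' ⬝ᵥ v) * (star w ⬝ᵥ w'))
      + p * ((star w ⬝ᵥ v) * (star v' ⬝ᵥ w'))
      + q * ((star w ⬝ᵥ (omegaMatrix d *ᵥ star v')) * (v ⬝ᵥ ((omegaMatrix d)ᴴ *ᵥ w'))) := by
  have h3 : star w ⬝ᵥ ((omegaMatrix d * (vecMulVec v (star v'))ᵀ * (omegaMatrix d)ᴴ) *ᵥ w')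
      = (star w ⬝ᵥ (omegaMatrix d *ᵥ star v')) * (v ⬝ᵥ ((omegaMatrix d)ᴴ *ᵥ w')) := by
    rw [transpose_vecMulVec, ← mulVec_mulVec, ← mulVec_mulVec, vecMulVec_mulVec]
    simp [mulVec_smul, mul_comm]
  have h2 : star w ⬝ᵥ (vecMulVec v (star v') *ᵥ w') = (star w ⬝ᵥ v) * (star v' ⬝ᵥ w') := by
    rw [vecMulVec_mulVec]; simp [mul_comm]
  simp only [sympMap, LinearMap.coe_mk, AddHom.coe_mk, add_mulVec, dotProduct_add, smul_mulVec,
    dotProduct_smul, h3, h2, trace_vecMulVec, smul_eq_mul, one_mulVec]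
  rw [dotProduct_comm v (star v')]
  ring

/-- Vectors of ℂᵏ ⊗ ℂᵈ are read as d × k matrices. The value then depends only on W V*, which ranges
over all matrices of rank at most k. -/
lemma ampliation_vecMulVec_form {d k : ℕ} (hd : 2 ≤ d) (p q : ℝ) (ψ φ : Fin k × Fin d → ℂ) :
    star φ ⬝ᵥ (ampliation k (sympMap d p q) (vecMulVec ψ (star ψ)) *ᵥ φ) =
      sympForm p q ((of fun x i => φ (i, x)) * (of fun x i => ψ (i, x))ᴴ) := by
  set W : Matrix (Fin d) (Fin k) ℂ := of fun x i => φ (i, x) with hW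
  set V : Matrix (Fin d) (Fin k) ℂ := of fun x i => ψ (i, x) with hV
  have h0 : star φ ⬝ᵥ (ampliation k (sympMap d p q) (vecMulVec ψ (star ψ)) *ᵥ φ) =
      ∑ i, ∑ j, star (W.col i) ⬝ᵥ
        (sympMap d p q (vecMulVec (V.col i) (star (V.col j))) *ᵥ (W.col j)) := by
    simp only [dotProduct, mulVec, ampliation, Fintype.sum_prod_type, of_apply, Pi.star_apply]
    refine Finset.sum_congr rfl fun i _ => ?_
    simp only [Finset.mul_sum]
    rw [Finset.sum_comm]
    rfl
  rw [h0]
  simp only [sympMap_vecMulVec_form]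
  have e1 : ∑ i, ∑ j, (star (V.col j) ⬝ᵥ V.col i) * (star (W.col i) ⬝ᵥ W.col j)
      = ((W * Vᴴ)ᴴ * (W * Vᴴ)).trace := by
    have := sum_mul_eq_trace_mul_transpose (Vᴴ * V)ᵀ (Wᴴ * W)
    rw [← transpose_mul, trace_transpose] at this
    rw [conjTranspose_mul, conjTranspose_conjTranspose,
      show V * Wᴴ * (W * Vᴴ) = V * (Wᴴ * W * Vᴴ) by simp only [Matrix.mul_assoc],
      trace_mul_comm, Matrix.mul_assoc, ← this]
    rfl
  have e2 : ∑ i, ∑ j, (star (W.col i) ⬝ᵥ V.col i) * (star (V.col j) ⬝ᵥ W.col j)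
      = star (W * Vᴴ).trace * (W * Vᴴ).trace := by
    rw [← trace_conjTranspose, conjTranspose_mul, conjTranspose_conjTranspose, trace_mul_comm V,
      trace_mul_comm W, trace, trace, Finset.sum_mul_sum]
    rfl
  have e3 : ∑ i, ∑ j, (star (W.col i) ⬝ᵥ (omegaMatrix d *ᵥ star (V.col j))) *
        (V.col i ⬝ᵥ ((omegaMatrix d)ᴴ *ᵥ W.col j))
      = ((W * Vᴴ)ᴴ * omegaMatrix d * (W * Vᴴ)ᵀ * omegaMatrix d).trace := by
    have := sum_mul_eq_trace_mul_transpose (Wᴴ * (omegaMatrix d * Vᴴᵀ))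
      (Vᵀ * ((omegaMatrix d)ᴴ * W))
    have h4 : (omegaMatrix d)ᴴᵀ = omegaMatrix d := by
      rw [omegaMatrix_conjTranspose hd, transpose_neg, omegaMatrix_transpose hd, neg_neg]
    simp only [transpose_mul, transpose_transpose, conjTranspose_mul, h4,
      conjTranspose_conjTranspose] at this ⊢
    rw [show V * Wᴴ * omegaMatrix d * (Vᴴᵀ * Wᵀ) * omegaMatrix d =
      V * (Wᴴ * (omegaMatrix d * Vᴴᵀ) * (Wᵀ * omegaMatrix d)) by simp only [Matrix.mul_assoc],
      trace_mul_comm, Matrix.mul_assoc, ← this]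
    rfl
  rw [sympForm, ← e1, ← e2, ← e3]
  simp only [Finset.sum_add_distrib, Finset.mul_sum]

lemma isHermitian_ampliation_vecMulVec {d k : ℕ} (p q : ℝ) (ψ : Fin k × Fin d → ℂ) :
    (ampliation k (sympMap d p q) (vecMulVec ψ (star ψ))).IsHermitian := by
  have h : ∀ Z : Matrix (Fin d) (Fin d) ℂ, sympMap d p q Zᴴ = (sympMap d p q Z)ᴴ := by
    intro Z
    simp only [sympMap, LinearMap.coe_mk, AddHom.coe_mk, conjTranspose_add, conjTranspose_smul,
      conjTranspose_mul, conjTranspose_conjTranspose, conjTranspose_one, trace_conjTranspose]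
    simp [Matrix.mul_assoc, conjTranspose_transpose_eq_transpose_conjTranspose]
  ext ⟨i, x⟩ ⟨j, y⟩
  have := congrFun (congrFun (h (vecMulVec (fun z => ψ (j, z)) (star fun z => ψ (i, z)))) x) y
  rw [conjTranspose_apply] at this ⊢
  rw [conjTranspose_vecMulVec, star_star] at this
  exact this.symm

open scoped MatrixOrder in
lemma Matrix.PosSemidef.exists_conjTranspose_mul_self {n : Type*} [Fintype n]
    {X : Matrix n n ℂ} (hX : X.PosSemidef) : ∃ B : Matrix n n ℂ, X = Bᴴ * B := by
  classical
  refine ⟨CFC.sqrt X, ?_⟩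
  have h := CFC.sqrt_mul_sqrt_self X (nonneg_iff_posSemidef.2 hX)
  rw [(nonneg_iff_posSemidef.1 (CFC.sqrt_nonneg X)).isHermitian.eq, h]

lemma isKPositive_sympMap_iff {d k : ℕ} (hd : 2 ≤ d) (p q : ℝ) :
    IsKPositive k (sympMap d p q) ↔
      ∀ W V : Matrix (Fin d) (Fin k) ℂ, 0 ≤ sympForm p q (W * Vᴴ) := by
  constructor
  · intro h W V
    have := (h _ (posSemidef_vecMulVec_self_star fun a => V a.2 a.1)).dotProduct_mulVec_nonneg
      (fun a => W a.2 a.1)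
    rw [ampliation_vecMulVec_form hd] at this
    exact this
  · intro h X hX
    obtain ⟨B, rfl⟩ := hX.exists_conjTranspose_mul_self
    have : ampliation k (sympMap d p q) (Bᴴ * B) =
        ∑ m, ampliation k (sympMap d p q) (vecMulVec (star (B m)) (star (star (B m)))) := by
      ext ⟨i, x⟩ ⟨j, y⟩
      rw [Matrix.sum_apply]
      simp only [ampliation, of_apply]
      rw [← Matrix.sum_apply, ← map_sum]
      refine congrArg (fun Z => sympMap d p q Z x y) ?_
      ext u v
      simp [Matrix.sum_apply, mul_apply, vecMulVec_apply]
    rw [this]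
    refine posSemidef_sum _ fun m _ => .of_dotProduct_mulVec_nonneg
      (isHermitian_ampliation_vecMulVec _ _ _) fun φ => ?_
    rw [ampliation_vecMulVec_form hd]
    exact h _ _

/-! ### Frobenius norm estimates. -/

/-- The squared Frobenius norm. -/
noncomputable def frobSq {m n : Type*} [Fintype m] [Fintype n] (A : Matrix m n ℂ) : ℝ :=
  ∑ i, ∑ j, ‖A i j‖ ^ 2

section frobSq

variable {l m n : Type*} [Fintype l] [Fintype m] [Fintype n]

lemma frobSq_nonneg (A : Matrix m n ℂ) : 0 ≤ frobSq A :=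
  Finset.sum_nonneg fun _ _ => Finset.sum_nonneg fun _ _ => sq_nonneg _

lemma frobSq_conjTranspose (A : Matrix m n ℂ) : frobSq Aᴴ = frobSq A := by
  rw [frobSq, frobSq, Finset.sum_comm]
  simp

lemma trace_conjTranspose_mul_self_eq_frobSq (A : Matrix m n ℂ) :
    (Aᴴ * A).trace = (frobSq A : ℂ) := by
  rw [frobSq, Finset.sum_comm]
  simp [trace, mul_apply, Complex.conj_mul']

lemma norm_trace_conjTranspose_mul_sq_le (A B : Matrix m n ℂ) :
    ‖(Aᴴ * B).trace‖ ^ 2 ≤ frobSq A * frobSq B := by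
  have h1 : (Aᴴ * B).trace = ∑ x : m × n, star (A x.1 x.2) * B x.1 x.2 := by
    rw [Fintype.sum_prod_type, Finset.sum_comm]
    simp [trace, mul_apply]
  have h2 : ‖(Aᴴ * B).trace‖ ≤ ∑ x : m × n, ‖A x.1 x.2‖ * ‖B x.1 x.2‖ := by
    rw [h1]
    refine (norm_sum_le _ _).trans (le_of_eq ?_)
    simp
  calc ‖(Aᴴ * B).trace‖ ^ 2 ≤ (∑ x : m × n, ‖A x.1 x.2‖ * ‖B x.1 x.2‖) ^ 2 := by gcongr
    _ ≤ (∑ x : m × n, ‖A x.1 x.2‖ ^ 2) * ∑ x : m × n, ‖B x.1 x.2‖ ^ 2 :=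
      Finset.sum_mul_sq_le_sq_mul_sq _ _ _
    _ = frobSq A * frobSq B := by simp [frobSq, Fintype.sum_prod_type]

/-- A preserves the norm of v, and the Frobenius norm dominates the operator norm. -/
lemma one_le_frobSq_of_conjTranspose_mul_self_mulVec {A : Matrix m n ℂ} {v : n → ℂ}
    (hv : v ≠ 0) (h : (Aᴴ * A) *ᵥ v = v) : 1 ≤ frobSq A := by
  have e1 : (star (A *ᵥ v) ⬝ᵥ (A *ᵥ v)) = star v ⬝ᵥ v := by
    rw [star_mulVec, ← dotProduct_mulVec, mulVec_mulVec, h]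
  have e2 : ∑ i, ‖(A *ᵥ v) i‖ ^ 2 = ∑ j, ‖v j‖ ^ 2 := by
    have := e1
    simp only [dotProduct, Pi.star_apply, RCLike.star_def, Complex.conj_mul'] at this
    exact_mod_cast this
  have e3 : ∑ i, ‖(A *ᵥ v) i‖ ^ 2 ≤ frobSq A * ∑ j, ‖v j‖ ^ 2 := by
    rw [frobSq, Finset.sum_mul]
    refine Finset.sum_le_sum fun i _ => ?_
    calc ‖(A *ᵥ v) i‖ ^ 2 ≤ (∑ j, ‖A i j‖ * ‖v j‖) ^ 2 := by
          gcongr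
          refine (norm_sum_le _ _).trans (le_of_eq ?_)
          simp
      _ ≤ _ := Finset.sum_mul_sq_le_sq_mul_sq _ _ _
  have e4 : 0 < ∑ j, ‖v j‖ ^ 2 := by
    obtain ⟨j, hj⟩ := Function.ne_iff.1 hv
    refine Finset.sum_pos' (fun _ _ => sq_nonneg _) ⟨j, Finset.mem_univ _, ?_⟩
    have := norm_pos_iff.2 hj
    positivity
  rw [e2] at e3
  by_contra! hlt
  nlinarith

end frobSq

/-! ### Normal form of `sympForm` on matrices of rank at most `k`. -/

/-- Gram-Schmidt is run on the columns of V padded with zero vectors to length d, which also covers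
rank-deficient V. Triangularity kills the coefficients beyond the first k. -/
lemma exists_isometry_mul {d k : ℕ} (hkd : k ≤ d) (V : Matrix (Fin d) (Fin k) ℂ) :
    ∃ (U : Matrix (Fin d) (Fin k) ℂ) (R : Matrix (Fin k) (Fin k) ℂ), Uᴴ * U = 1 ∧ V = U * R := by
  let f : Fin d → EuclideanSpace ℂ (Fin d) := fun j =>
    if h : (j : ℕ) < k then WithLp.toLp 2 (V.col ⟨j, h⟩) else 0
  let b := InnerProductSpace.gramSchmidtOrthonormalBasis (𝕜 := ℂ)
    (by simp : Module.finrank ℂ (EuclideanSpace ℂ (Fin d)) = Fintype.card (Fin d)) f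
  let c : Fin k → Fin d := Fin.castLE hkd
  have hf : ∀ i : Fin k, f (c i) = WithLp.toLp 2 (V.col i) := fun i => by
    simp [f, c]
  refine ⟨of fun x i => b (c i) x, of fun i j => inner ℂ (b (c i)) (f (c j)), ?_, ?_⟩
  · ext i j
    have h := orthonormal_iff_ite.1 b.orthonormal (c i) (c j)
    rw [PiLp.inner_apply] at h
    simp only [mul_apply, conjTranspose_apply, of_apply, one_apply]
    rw [show (if i = j then (1 : ℂ) else 0) = if c i = c j then 1 else 0 by simp [c], ← h]
    exact Finset.sum_congr rfl fun x _ => by simp [mul_comm]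
  · ext x j
    have h := b.sum_repr' (f (c j))
    have h2 : V x j = (f (c j)) x := by rw [hf]; rfl
    rw [h2, ← h]
    simp only [mul_apply, of_apply, WithLp.ofLp_sum, Finset.sum_apply, WithLp.ofLp_smul,
      Pi.smul_apply, smul_eq_mul]
    rw [← Finset.sum_subset (Finset.subset_univ (Finset.univ.map (Fin.castLEEmb hkd)))]
    · rw [Finset.sum_map]
      exact Finset.sum_congr rfl fun i _ => by simp [c, mul_comm]
    · intro i _ hi
      have : c j < i := by
        by_contra! hle
        refine hi (Finset.mem_map.2 ⟨⟨i, ?_⟩, Finset.mem_univ _, rfl⟩)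
        have : (i : ℕ) ≤ j := hle
        omega
      rw [InnerProductSpace.gramSchmidtOrthonormalBasis_inv_triangular _ _ this, zero_mul]

lemma omegaMatrix_mul_self {d : ℕ} (hd : 2 ≤ d) (he : Even d) :
    omegaMatrix d * omegaMatrix d = -1 := by
  obtain ⟨h, rfl⟩ := he
  have hh : (h + h) / 2 = h := by omega
  ext i j
  rw [mul_apply, neg_apply, one_apply]
  by_cases hi : (i : ℕ) < h
  · rw [Finset.sum_eq_single ⟨i + h, by omega⟩]
    · simp only [omegaMatrix, of_apply, hh, Fin.ext_iff]
      split_ifs <;> first | omega | simp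
    · intro y _ hy
      simp only [omegaMatrix, of_apply, hh, ne_eq, Fin.ext_iff] at hy ⊢
      split_ifs <;> first | omega | simp
    · simp
  · rw [Finset.sum_eq_single ⟨i - h, by omega⟩]
    · simp only [omegaMatrix, of_apply, hh, Fin.ext_iff]
      split_ifs <;> first | omega | simp
    · intro y _ hy
      simp only [omegaMatrix, of_apply, hh, ne_eq, Fin.ext_iff] at hy ⊢
      split_ifs <;> first | omega | simp
    · simp

/-- An antisymmetric matrix pairs to zero with every symmetric one, so only the antisymmetric part
of L contributes. -/
lemma trace_mul_antisymm_comm {k : ℕ} {H : Matrix (Fin k) (Fin k) ℂ} (hH : Hᵀ = -H)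
    (L : Matrix (Fin k) (Fin k) ℂ) : (H * L).trace = (H * (L - Lᵀ)).trace / 2 := by
  have : (H * Lᵀ).trace = - (H * L).trace := by
    rw [← trace_transpose, transpose_mul, hH, transpose_transpose, Matrix.mul_neg, trace_neg,
      trace_mul_comm]
  rw [Matrix.mul_sub, trace_sub, this]
  ring

lemma frobSq_add_sub_transpose {k : ℕ} (L : Matrix (Fin k) (Fin k) ℂ) :
    (Lᴴ * Lᵀ).trace = ((frobSq (L + Lᵀ) / 4 - frobSq (L - Lᵀ) / 4 : ℝ) : ℂ) ∧
      frobSq L = frobSq (L + Lᵀ) / 4 + frobSq (L - Lᵀ) / 4 := by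
  have h1 : (Lᵀᴴ * L).trace = (Lᴴ * Lᵀ).trace := by
    rw [← trace_transpose, transpose_mul, conjTranspose_transpose_eq_transpose_conjTranspose,
      transpose_transpose, trace_mul_comm]
  have h2 : (Lᵀᴴ * Lᵀ).trace = (Lᴴ * L).trace := by
    rw [← trace_transpose, transpose_mul, conjTranspose_transpose_eq_transpose_conjTranspose,
      transpose_transpose, transpose_transpose, trace_mul_comm]
  have hp := trace_conjTranspose_mul_self_eq_frobSq (L + Lᵀ)
  have hm := trace_conjTranspose_mul_self_eq_frobSq (L - Lᵀ)
  have h0 := trace_conjTranspose_mul_self_eq_frobSq L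
  rw [conjTranspose_add, Matrix.add_mul, Matrix.mul_add, Matrix.mul_add, trace_add, trace_add,
    trace_add, h1, h2, h0] at hp
  rw [conjTranspose_sub, Matrix.sub_mul, Matrix.mul_sub, Matrix.mul_sub, trace_sub, trace_sub,
    trace_sub, h1, h2, h0] at hm
  constructor
  · push_cast
    rw [← hp, ← hm]
    ring
  · have : (frobSq L : ℂ) = ((frobSq (L + Lᵀ) / 4 + frobSq (L - Lᵀ) / 4 : ℝ) : ℂ) := by
      push_cast
      rw [← hp, ← hm]
      ring
    exact_mod_cast this

/-- With r = ‖U*E‖², the lower bound is the nonnegativity of ‖(1 - EE*)(1 - UU*)‖² = d - 2k + r. For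
odd k the antisymmetric U*E is singular; a kernel vector of E*U is fixed by N*N, whence k - r = ‖N‖²
≥ 1. -/
lemma frobSq_compression_bounds {d k : ℕ} {U E : Matrix (Fin d) (Fin k) ℂ}
    (hU : Uᴴ * U = 1) (hE : Eᴴ * E = 1) (hH : (Uᴴ * E)ᵀ = -(Uᴴ * E)) :
    frobSq (U - E * (Eᴴ * U)) = k - frobSq (Uᴴ * E) ∧ 2 * (k : ℝ) - d ≤ frobSq (Uᴴ * E) ∧
      (Odd k → frobSq (Uᴴ * E) ≤ k - 1) := by
  have hHH : (Uᴴ * E)ᴴ = Eᴴ * U := by rw [conjTranspose_mul, conjTranspose_conjTranspose]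
  set N := U - E * (Eᴴ * U) with hN
  have hEN : Eᴴ * N = 0 := by
    rw [hN, Matrix.mul_sub, ← Matrix.mul_assoc, hE, Matrix.one_mul, sub_self]
  have hNN : Nᴴ * N = 1 - (Uᴴ * E) * (Eᴴ * U) := by
    conv_lhs => rw [hN]
    rw [conjTranspose_sub, conjTranspose_mul E, Matrix.sub_mul, Matrix.mul_assoc _ Eᴴ, hEN,
      Matrix.mul_zero, sub_zero, Matrix.mul_sub, hU, Matrix.mul_assoc]
  have h1 : frobSq N = k - frobSq (Uᴴ * E) := by
    have e := trace_conjTranspose_mul_self_eq_frobSq N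
    rw [hNN, trace_sub, trace_one, trace_mul_comm, ← hHH,
      trace_conjTranspose_mul_self_eq_frobSq, Fintype.card_fin] at e
    exact_mod_cast e.symm
  refine ⟨h1, ?_, fun hk => ?_⟩
  · have hP : frobSq ((1 - E * Eᴴ) * (1 - U * Uᴴ)) = (d - k) - (k - frobSq (Uᴴ * E)) := by
      have e := trace_conjTranspose_mul_self_eq_frobSq ((1 - E * Eᴴ) * (1 - U * Uᴴ))
      generalize frobSq ((1 - E * Eᴴ) * (1 - U * Uᴴ)) = g at e ⊢
      have p1 : (1 - E * Eᴴ)ᴴ * (1 - E * Eᴴ) = 1 - E * Eᴴ := by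
        have : E * Eᴴ * (E * Eᴴ) = E * Eᴴ := by
          rw [Matrix.mul_assoc, ← Matrix.mul_assoc Eᴴ, hE, Matrix.one_mul]
        simp [conjTranspose_sub, Matrix.sub_mul, Matrix.mul_sub, this]
      have p2 : (1 - U * Uᴴ) * (1 - U * Uᴴ)ᴴ = 1 - U * Uᴴ := by
        have : U * Uᴴ * (U * Uᴴ) = U * Uᴴ := by
          rw [Matrix.mul_assoc, ← Matrix.mul_assoc Uᴴ, hU, Matrix.one_mul]
        simp [conjTranspose_sub, Matrix.sub_mul, Matrix.mul_sub, this]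
      have p3 : (E * Eᴴ * (U * Uᴴ)).trace = frobSq (Uᴴ * E) := by
        rw [← trace_conjTranspose_mul_self_eq_frobSq, hHH, Matrix.mul_assoc, trace_mul_comm]
        simp only [Matrix.mul_assoc]
      rw [conjTranspose_mul, Matrix.mul_assoc, ← Matrix.mul_assoc (1 - E * Eᴴ)ᴴ, p1, trace_mul_comm,
        Matrix.mul_assoc, p2, Matrix.sub_mul, Matrix.mul_sub, Matrix.mul_sub, trace_sub, trace_sub,
        trace_sub, Matrix.one_mul, Matrix.one_mul, Matrix.mul_one, p3, trace_mul_comm U,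
        trace_mul_comm E, hU, hE, trace_one, trace_one, Fintype.card_fin, Fintype.card_fin] at e
      exact_mod_cast e.symm
    have := frobSq_nonneg ((1 - E * Eᴴ) * (1 - U * Uᴴ))
    linarith
  · have hdet : (Eᴴ * U).det = 0 := by
      have e := congrArg det hH
      rw [det_transpose, det_neg, Fintype.card_fin, hk.neg_one_pow] at e
      have : (Uᴴ * E).det = 0 := by linear_combination e / 2
      rw [← hHH, det_conjTranspose, this, star_zero]
    obtain ⟨v, hv, hv0⟩ := exists_mulVec_eq_zero_iff.2 hdet
    have := one_le_frobSq_of_conjTranspose_mul_self_mulVec (A := N) hv (by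
      rw [hNN, sub_mulVec, one_mulVec, ← mulVec_mulVec, hv0, mulVec_zero, sub_zero])
    linarith

lemma sympForm_mul_conjTranspose_eq {d k : ℕ} (hd : 2 ≤ d) (he : Even d) (hkd : k ≤ d) (p q : ℝ)
    (W V : Matrix (Fin d) (Fin k) ℂ) :
    ∃ σ α m r t₁ t₂ t : ℝ, 0 ≤ σ ∧ 0 ≤ α ∧ 0 ≤ m ∧ 0 ≤ r ∧ 2 * (k : ℝ) - d ≤ r ∧ r ≤ k ∧
      (Odd k → r ≤ k - 1) ∧ t₁ ^ 2 ≤ r * α ∧ t₂ ^ 2 ≤ (k - r) * m ∧ 0 ≤ t ∧ t ≤ t₁ + t₂ ∧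
      sympForm p q (W * Vᴴ) =
        (((1 - p - q) / d * (σ + α + m) + p * t ^ 2 + q * (σ - α) : ℝ) : ℂ) := by
  obtain ⟨U, R, hU, rfl⟩ := exists_isometry_mul hkd V
  rw [conjTranspose_mul, ← Matrix.mul_assoc]
  generalize W * Rᴴ = M
  set O := omegaMatrix d with hO
  have hOt : Oᵀ = -O := omegaMatrix_transpose hd
  have hOs : Oᴴ = -O := omegaMatrix_conjTranspose hd
  have hOO : O * O = -1 := omegaMatrix_mul_self hd he
  -- This choice of E turns the Ω-term of the form into Tr(L* Lᵀ) with L = E*M.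
  set E := O * Uᴴᵀ with hE
  have hEs : Eᴴ = -(Uᵀ * O) := by
    rw [hE, conjTranspose_mul, hOs, conjTranspose_transpose_eq_transpose_conjTranspose,
      conjTranspose_conjTranspose, Matrix.mul_neg]
  have hEE : Eᴴ * E = 1 := by
    rw [hEs, hE, Matrix.neg_mul, Matrix.mul_assoc, ← Matrix.mul_assoc O, hOO, Matrix.neg_mul,
      Matrix.one_mul, Matrix.mul_neg, neg_neg, ← transpose_mul, hU, transpose_one]
  have hH : (Uᴴ * E)ᵀ = -(Uᴴ * E) := by
    rw [hE, transpose_mul, transpose_mul, transpose_transpose, hOt, Matrix.mul_neg, Matrix.neg_mul,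
      Matrix.mul_assoc]
  obtain ⟨hN, hr, hodd⟩ := frobSq_compression_bounds hU hEE hH
  set N := U - E * (Eᴴ * U) with hNdef
  set L := Eᴴ * M with hL
  set M₂ := M - E * L with hM₂
  have hEM₂ : Eᴴ * M₂ = 0 := by
    rw [hM₂, Matrix.mul_sub, ← Matrix.mul_assoc, hEE, Matrix.one_mul, sub_self]
  obtain ⟨hq, hfL⟩ := frobSq_add_sub_transpose L
  have hfM : frobSq M = frobSq L + frobSq M₂ := by
    have e := trace_conjTranspose_mul_self_eq_frobSq M
    have hMd : M = E * L + M₂ := by rw [hM₂]; abel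
    have hM₂E : M₂ᴴ * E = 0 := by
      rw [← conjTranspose_conjTranspose E, ← conjTranspose_mul, hEM₂, conjTranspose_zero]
    have e2 : Mᴴ * M = Lᴴ * L + M₂ᴴ * M₂ := by
      rw [hMd, conjTranspose_add, conjTranspose_mul, Matrix.add_mul, Matrix.mul_add, Matrix.mul_add,
        Matrix.mul_assoc _ Eᴴ, ← Matrix.mul_assoc Eᴴ, hEE, Matrix.one_mul, Matrix.mul_assoc _ Eᴴ,
        hEM₂, Matrix.mul_zero, ← Matrix.mul_assoc M₂ᴴ, hM₂E, Matrix.zero_mul, add_zero, zero_add]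
    rw [e2, trace_add, trace_conjTranspose_mul_self_eq_frobSq,
      trace_conjTranspose_mul_self_eq_frobSq] at e
    exact_mod_cast e.symm
  have hXX : ((M * Uᴴ)ᴴ * (M * Uᴴ)).trace = (frobSq M : ℂ) := by
    rw [conjTranspose_mul, conjTranspose_conjTranspose, Matrix.mul_assoc, trace_mul_comm,
      ← Matrix.mul_assoc Mᴴ, Matrix.mul_assoc _ Uᴴ, hU, Matrix.mul_one,
      trace_conjTranspose_mul_self_eq_frobSq]
  have hqX : ((M * Uᴴ)ᴴ * O * (M * Uᴴ)ᵀ * O).trace = (Lᴴ * Lᵀ).trace := by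
    have l1 : Lᴴ = Mᴴ * E := by rw [hL, conjTranspose_mul, conjTranspose_conjTranspose]
    have l2 : Lᵀ = Mᵀ * O * U := by
      rw [hL, transpose_mul, hEs, transpose_neg, transpose_mul, transpose_transpose, hOt,
        Matrix.neg_mul, neg_neg, Matrix.mul_assoc]
    rw [l1, l2, hE, conjTranspose_mul, conjTranspose_conjTranspose, transpose_mul]
    simp only [Matrix.mul_assoc]
    rw [trace_mul_comm]
    simp only [Matrix.mul_assoc]
  have htr : (M * Uᴴ).trace = (Uᴴ * E * L).trace + (Nᴴ * M₂).trace := by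
    have hMd : M = E * L + M₂ := by rw [hM₂]; abel
    -- Since E*M₂ = 0, U may be replaced by N, whose squared norm is only k - r; this is the
    -- constant needed in the bound on t₂.
    have : Nᴴ * M₂ = Uᴴ * M₂ := by
      rw [hNdef, conjTranspose_sub, conjTranspose_mul E, Matrix.sub_mul, Matrix.mul_assoc _ Eᴴ,
        hEM₂, Matrix.mul_zero, sub_zero]
    rw [trace_mul_comm, this, ← trace_add, Matrix.mul_assoc, ← Matrix.mul_add, ← hMd]
  refine ⟨frobSq (L + Lᵀ) / 4, frobSq (L - Lᵀ) / 4, frobSq M₂, frobSq (Uᴴ * E),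
    ‖(Uᴴ * E * L).trace‖, ‖(Nᴴ * M₂).trace‖, ‖(M * Uᴴ).trace‖, ?_, ?_, frobSq_nonneg _,
    frobSq_nonneg _, hr, ?_, hodd, ?_, ?_, norm_nonneg _, ?_, ?_⟩
  · have := frobSq_nonneg (L + Lᵀ); positivity
  · have := frobSq_nonneg (L - Lᵀ); positivity
  · have := frobSq_nonneg N; linarith
  · have := norm_trace_conjTranspose_mul_sq_le (Uᴴ * E)ᴴ (L - Lᵀ)
    rw [conjTranspose_conjTranspose, frobSq_conjTranspose] at this
    rw [trace_mul_antisymm_comm hH, norm_div, div_pow]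
    norm_num
    linarith
  · rw [← hN]
    exact norm_trace_conjTranspose_mul_sq_le N M₂
  · rw [htr]
    exact norm_add_le _ _
  · rw [sympForm, hXX, hqX, hq, hfM, hfL, RCLike.star_def, Complex.conj_mul']
    push_cast
    ring

/-! ### Necessary conditions from explicit test matrices. -/

lemma exists_eq_mul_conjTranspose_of_card_le {d k : ℕ} (hkd : k ≤ d) {J : Finset (Fin d)}
    (hJ : J.card ≤ k) {X : Matrix (Fin d) (Fin d) ℂ} (hX : ∀ x, ∀ y ∉ J, X x y = 0) :
    ∃ W V : Matrix (Fin d) (Fin k) ℂ, X = W * Vᴴ := by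
  obtain ⟨J', hJJ', hJ'⟩ := Finset.exists_superset_card_eq hJ (by simpa using hkd)
  let σ := J'.orderEmbOfFin hJ'
  refine ⟨of fun x i => X x (σ i), of fun y i => if y = σ i then 1 else 0, ?_⟩
  ext x y
  simp only [mul_apply, conjTranspose_apply, of_apply]
  by_cases hy : y ∈ J'
  · have : y ∈ Set.range σ := by rw [Finset.range_orderEmbOfFin]; exact hy
    obtain ⟨i, rfl⟩ := this
    rw [Finset.sum_eq_single i]
    · simp
    · intro j _ hj
      simp [hj.symm]
    · simp
  · rw [hX x y fun h => hy (hJJ' h), Finset.sum_eq_zero]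
    intro i _
    have : y ≠ σ i := fun h => hy (h ▸ Finset.orderEmbOfFin_mem _ _ _)
    simp [this]

lemma IsKPositive.sympForm_nonneg {d k : ℕ} (hd : 2 ≤ d) (hkd : k ≤ d) {p q : ℝ}
    (h : IsKPositive k (sympMap d p q)) {J : Finset (Fin d)} (hJ : J.card ≤ k)
    {X : Matrix (Fin d) (Fin d) ℂ} (hX : ∀ x, ∀ y ∉ J, X x y = 0) : 0 ≤ sympForm p q X := by
  obtain ⟨W, V, rfl⟩ := exists_eq_mul_conjTranspose_of_card_le hkd hJ hX
  exact (isKPositive_sympMap_iff hd p q).1 h W V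

/-- The test matrix X is a traceless matrix unit for which XΩ is symmetric, so its Ω-term is +‖X‖².
-/
lemma IsKPositive.nonneg_add {d k : ℕ} (hd : 4 ≤ d) (he : Even d) (hk : 1 ≤ k) (hkd : k ≤ d)
    {p q : ℝ} (h : IsKPositive k (sympMap d p q)) : 0 ≤ (1 - p - q) / d + q := by
  obtain ⟨m, rfl⟩ := he
  have hm : (m + m) / 2 = m := by omega
  let i₀ : Fin (m + m) := ⟨0, by omega⟩
  let i₁ : Fin (m + m) := ⟨m, by omega⟩
  have hne : i₀ ≠ i₁ := by simp [i₀, i₁]; omega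
  have hX := h.sympForm_nonneg (by omega) hkd (J := {i₁}) (by simpa using hk)
    (X := single i₀ i₁ 1) (fun x y hy => by
      rw [single_apply_of_col_ne]
      exact fun h => hy (by simp [h]))
  rw [sympForm, conjTranspose_single, transpose_single, single_mul_single_same,
    trace_single_eq_same, trace_single_eq_of_ne _ _ _ hne, single_mul_mul_single,
    trace_single_mul] at hX
  have hO : omegaMatrix (m + m) i₀ i₁ = 1 := by simp [omegaMatrix, hm, i₀, i₁]
  simp only [hO, star_one, star_zero, mul_one, mul_zero, add_zero, one_smul] at hX
  exact_mod_cast hX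

/-- The test matrix X is traceless of rank two with XΩ antisymmetric, so its Ω-term is -‖X‖². Two
distinct symplectic coordinate pairs are needed, hence d ≥ 4. -/
lemma IsKPositive.nonneg_sub {d k : ℕ} (hd : 4 ≤ d) (he : Even d) (hk : 2 ≤ k) (hkd : k ≤ d)
    {p q : ℝ} (h : IsKPositive k (sympMap d p q)) : 0 ≤ (1 - p - q) / d - q := by
  obtain ⟨m, rfl⟩ := he
  have hm : (m + m) / 2 = m := by omega
  let i₀ : Fin (m + m) := ⟨0, by omega⟩
  let i₁ : Fin (m + m) := ⟨1, by omega⟩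
  let j₀ : Fin (m + m) := ⟨m, by omega⟩
  let j₁ : Fin (m + m) := ⟨1 + m, by omega⟩
  have h1 : i₀ ≠ j₁ := by simp [i₀, j₁]; omega
  have h2 : i₁ ≠ j₀ := by simp [i₁, j₀]; omega
  have h3 : i₀ ≠ i₁ := by simp [i₀, i₁]
  have hX := h.sympForm_nonneg (by omega) hkd (J := {j₀, j₁}) (Finset.card_le_two.trans hk)
    (X := single i₀ j₁ 1 - single i₁ j₀ 1) (fun x y hy => by
      rw [Matrix.sub_apply, single_apply_of_col_ne, single_apply_of_col_ne, sub_zero]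
      · exact fun h => hy (by simp [h])
      · exact fun h => hy (by simp [h]))
  have o1 : omegaMatrix (m + m) i₀ j₁ = 0 := by simp [omegaMatrix, hm, i₀, j₁]; omega
  have o2 : omegaMatrix (m + m) i₁ j₀ = 0 := by simp [omegaMatrix, hm, i₁, j₀]; omega
  have o3 : omegaMatrix (m + m) i₀ j₀ = 1 := by simp [omegaMatrix, hm, i₀, j₀]
  have o4 : omegaMatrix (m + m) i₁ j₁ = 1 := by simp [omegaMatrix, hm, i₁, j₁]
  rw [sympForm, conjTranspose_sub, transpose_sub, conjTranspose_single, transpose_single,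
    conjTranspose_single, transpose_single] at hX
  simp only [Matrix.sub_mul, Matrix.mul_sub, trace_sub, single_mul_mul_single, trace_single_mul,
    trace_single_eq_of_ne _ _ _ h1, trace_single_eq_of_ne _ _ _ h2, single_mul_single_same,
    trace_single_eq_same, single_mul_single_of_ne _ _ _ _ h3,
    single_mul_single_of_ne _ _ _ _ h3.symm,
    o1, o2, o3, o4, star_one, trace_zero] at hX
  have hX' : 0 ≤ 2 * ((1 - p - q) / ((m + m : ℕ) : ℝ) - q) := by
    have : (0 : ℂ) ≤ ((2 * ((1 - p - q) / ((m + m : ℕ) : ℝ) - q) : ℝ) : ℂ) := by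
      convert hX using 1
      push_cast
      simp
      ring
    exact_mod_cast this
  linarith

/-- The Hermitian form of the Choi matrix of `sympMap d p q` at `c` times a projection onto a
`u`-dimensional symplectic subspace plus `e` times a projection onto a `(k - u)`-dimensional
isotropic subspace orthogonal to it. -/
noncomputable def projForm (d k u c e p q : ℝ) : ℝ :=
  u * ((1 - p - q) / d - q) * c ^ 2 + (k - u) * ((1 - p - q) / d) * e ^ 2
    + p * (u * c + (k - u) * e) ^ 2

lemma sum_fin_ite_lt_ite_lt {h m n : ℕ} (hmn : m + n ≤ h) (A B : ℂ) :
    ∑ i : Fin h, (if (i : ℕ) < m then A else if (i : ℕ) < m + n then B else 0) = m * A + n * B := by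
  rw [Fin.sum_univ_eq_sum_range fun i => if i < m then A else if i < m + n then B else 0]
  obtain ⟨l, rfl⟩ := Nat.exists_eq_add_of_le hmn
  rw [Finset.sum_range_add, Finset.sum_range_add, Finset.sum_congr rfl (g := fun _ => A),
    Finset.sum_congr (s₁ := Finset.range n) rfl (g := fun _ => B),
    Finset.sum_congr (s₁ := Finset.range l) rfl (g := fun _ => 0)]
  · simp
  · intro i _
    rw [if_neg (by omega), if_neg (by omega)]
  · intro i hi
    rw [if_neg (by omega), if_pos (by simp at hi; omega)]
  · intro i hi
    rw [if_pos (by simpa using hi)]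

/-- The diagonal test matrix carries c on both members of u/2 symplectic coordinate pairs and e on
one member of k - u further pairs. These fit into the d/2 available pairs exactly when 2k ≤ d + u.
-/
lemma IsKPositive.projForm_nonneg {d k u : ℕ} (hd : 4 ≤ d) (he : Even d) (hkd : k ≤ d)
    (hu : Even u) (huk : u ≤ k) (hud : 2 * k ≤ d + u)
    {p q : ℝ} (h : IsKPositive k (sympMap d p q)) (c e : ℝ) : 0 ≤ projForm d k u c e p q := by
  obtain ⟨w, rfl⟩ := he
  obtain ⟨m, rfl⟩ := hu
  obtain ⟨n, rfl⟩ := Nat.exists_eq_add_of_le huk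
  have hw : (w + w) / 2 = w := by omega
  have hmn : m + n ≤ w := by omega
  let δ₁ : Fin w → ℂ := fun i => if (i : ℕ) < m then (c : ℂ) else if (i : ℕ) < m + n then e else 0
  -- The redundant inner branch keeps the shape required by `sum_fin_ite_lt_ite_lt`.
  let δ₂ : Fin w → ℂ := fun i => if (i : ℕ) < m then (c : ℂ) else if (i : ℕ) < m + n then 0 else 0
  let δ : Fin (w + w) → ℂ := Fin.append δ₁ δ₂
  have hδ : star δ = δ := by
    ext x
    refine Fin.addCases (fun i => ?_) (fun i => ?_) x <;>
      simp only [Pi.star_apply, δ, Fin.append_left, Fin.append_right, δ₁, δ₂] <;>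
      split_ifs <;> simp
  let J₁ : Finset (Fin (w + w)) :=
    Finset.univ.map ((Fin.castLEEmb hmn).trans (Fin.castAddEmb w))
  let J₂ : Finset (Fin (w + w)) :=
    Finset.univ.map ((Fin.castLEEmb (show m ≤ w by omega)).trans (Fin.natAddEmb w))
  have hJ : (J₁ ∪ J₂).card ≤ m + m + n := by
    refine (Finset.card_union_le _ _).trans ?_
    simp only [J₁, J₂, Finset.card_map, Finset.card_univ, Fintype.card_fin]
    omega
  have hX := h.sympForm_nonneg (by omega) hkd hJ (X := diagonal δ) (fun x y hy => by
    by_cases hxy : x = y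
    · subst hxy
      rw [diagonal_apply_eq]
      revert hy
      refine Fin.addCases (fun i hi => ?_) (fun i hi => ?_) x
      · simp only [δ, Fin.append_left, δ₁]
        have : ¬ (i : ℕ) < m + n := fun hlt => hi (Finset.mem_union_left _
          (Finset.mem_map.2 ⟨⟨i, hlt⟩, Finset.mem_univ _, rfl⟩))
        rw [if_neg (by omega), if_neg this]
      · simp only [δ, Fin.append_right, δ₂]
        have : ¬ (i : ℕ) < m := fun hlt => hi (Finset.mem_union_right _
          (Finset.mem_map.2 ⟨⟨i, hlt⟩, Finset.mem_univ _, rfl⟩))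
        rw [if_neg this]
        simp
    · exact diagonal_apply_ne _ hxy)
  have t1 : (diagonal δ).trace = (m + m : ℂ) * c + n * e := by
    rw [trace_diagonal, Fin.sum_univ_add]
    simp only [δ, Fin.append_left, Fin.append_right, δ₁, δ₂, sum_fin_ite_lt_ite_lt hmn]
    ring
  have t2 : ((diagonal δ)ᴴ * diagonal δ).trace = (m + m : ℂ) * c ^ 2 + n * e ^ 2 := by
    have e1 : ∀ i, δ₁ i * δ₁ i =
        if (i : ℕ) < m then (c : ℂ) ^ 2 else if (i : ℕ) < m + n then (e : ℂ) ^ 2 else 0 := by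
      intro i; simp only [δ₁]; split_ifs <;> ring
    have e2 : ∀ i, δ₂ i * δ₂ i =
        if (i : ℕ) < m then (c : ℂ) ^ 2 else if (i : ℕ) < m + n then 0 else 0 := by
      intro i; simp only [δ₂]; split_ifs <;> ring
    rw [diagonal_conjTranspose, hδ, diagonal_mul_diagonal, trace_diagonal, Fin.sum_univ_add]
    simp only [δ, Fin.append_left, Fin.append_right, e1, e2, sum_fin_ite_lt_ite_lt hmn]
    ring
  have t3 : ((diagonal δ)ᴴ * omegaMatrix (w + w) * (diagonal δ)ᵀ * omegaMatrix (w + w)).trace =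
      -((m + m : ℂ) * c ^ 2) := by
    -- Conjugation by Ω swaps the two halves of the diagonal, up to sign. Only the c-entries occur
    -- in both halves, so e drops out of this trace.
    have e0 : ∀ x, (omegaMatrix (w + w) * diagonal δ * omegaMatrix (w + w)) x x =
        -Fin.append δ₂ δ₁ x := by
      intro x
      rw [mul_apply]
      simp only [mul_diagonal]
      refine Fin.addCases (fun i => ?_) (fun i => ?_) x
      · rw [Finset.sum_eq_single (Fin.natAdd w i)]
        · simp only [omegaMatrix, of_apply, hw, Fin.val_natAdd, Fin.val_castAdd, δ,
            Fin.append_left, Fin.append_right]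
          split_ifs <;> first | omega | simp
        · intro y _ hy
          simp only [omegaMatrix, of_apply, hw, ne_eq, Fin.ext_iff, Fin.val_natAdd,
            Fin.val_castAdd] at hy ⊢
          split_ifs <;> first | omega | simp
        · simp
      · rw [Finset.sum_eq_single (Fin.castAdd w i)]
        · simp only [omegaMatrix, of_apply, hw, Fin.val_natAdd, Fin.val_castAdd, δ,
            Fin.append_left, Fin.append_right]
          split_ifs <;> first | omega | simp
        · intro y _ hy
          simp only [omegaMatrix, of_apply, hw, ne_eq, Fin.ext_iff, Fin.val_natAdd,
            Fin.val_castAdd] at hy ⊢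
          split_ifs <;> first | omega | simp
        · simp
    have e1 : ∀ i, δ₁ i * δ₂ i =
        if (i : ℕ) < m then (c : ℂ) ^ 2 else if (i : ℕ) < m + n then 0 else 0 := by
      intro i; simp only [δ₁, δ₂]; split_ifs <;> ring
    have e2 : ∀ i, δ₂ i * δ₁ i =
        if (i : ℕ) < m then (c : ℂ) ^ 2 else if (i : ℕ) < m + n then 0 else 0 := by
      intro i; rw [mul_comm, e1]
    rw [diagonal_conjTranspose, hδ, diagonal_transpose, Matrix.mul_assoc, Matrix.mul_assoc,
      ← Matrix.mul_assoc (omegaMatrix _), trace]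
    simp only [diag_apply, diagonal_mul, e0]
    rw [Fin.sum_univ_add]
    simp only [δ, Fin.append_left, Fin.append_right, mul_neg, Finset.sum_neg_distrib, e1, e2,
      sum_fin_ite_lt_ite_lt hmn]
    ring
  rw [sympForm, t1, t2, t3] at hX
  have : (0 : ℂ) ≤
      (projForm ((w + w : ℕ) : ℝ) ((m + m + n : ℕ) : ℝ) ((m + m : ℕ) : ℝ) c e p q : ℂ) := by
    convert hX using 1
    simp only [projForm]
    push_cast
    simp
    ring
  exact_mod_cast this

/-! ### The conic, and equality of the two regions. -/

/-- The polynomial `fQuad`, divided by `d ^ 2`. -/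
noncomputable def conic (d k u p q : ℝ) : ℝ :=
  (1 - p - q) / d * ((1 - p - q) / d - q) + p * (k * ((1 - p - q) / d) - (k - u) * q)

lemma fQuad_eq_conic {d k : ℕ} (hd : 0 < d) (u p q : ℝ) :
    fQuad d k u p q = (d : ℝ) ^ 2 * conic d k u p q := by
  have : (d : ℝ) ≠ 0 := by positivity
  rw [fQuad, conic]
  field_simp
  ring

/-- The points `(p, q)` satisfying the inequalities coming from rank one symmetric matrices,
rank two antisymmetric matrices and the forms `projForm` for `u = r` and `u = R`. -/
def projRegion (d k r R : ℝ) : Set (ℝ × ℝ) :=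
  {z | 0 ≤ (1 - z.1 - z.2) / d + z.2 ∧ 0 ≤ (1 - z.1 - z.2) / d - z.2 ∧
    (∀ c e, 0 ≤ projForm d k r c e z.1 z.2) ∧ ∀ c e, 0 ≤ projForm d k R c e z.1 z.2}

/-- Completing the square: the sign of `conic` decides the sign of the form, and the critical
direction is (c, e) = (a, a - q) with a = (1 - p - q)/d. -/
lemma projForm_mul_eq (d k u c e p q : ℝ) :
    (u * ((1 - p - q) / d) + (k - u) * ((1 - p - q) / d - q)) * projForm d k u c e p q =
      u * (k - u) * (((1 - p - q) / d - q) * c - (1 - p - q) / d * e) ^ 2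
        + conic d k u p q * (u * c + (k - u) * e) ^ 2 := by
  rw [projForm, conic]
  ring

lemma projForm_nonneg_of_nonneg {d k u p q : ℝ} (hu : 0 ≤ u) (huk : u ≤ k)
    (h₁ : 0 ≤ (1 - p - q) / d + q) (h₂ : 0 ≤ (1 - p - q) / d - q) (hp : 0 ≤ p) (c e : ℝ) :
    0 ≤ projForm d k u c e p q := by
  have ha : 0 ≤ (1 - p - q) / d := by linarith
  have := sub_nonneg.2 huk
  rw [projForm]
  positivity

lemma weight_pos {k u a b : ℝ} (hk : 0 < k) (hu : 0 ≤ u) (huk : u ≤ k) (ha : 0 < a) (hb : 0 < b) :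
    0 < u * a + (k - u) * b := by
  rcases hu.eq_or_lt with rfl | hu
  · simp; positivity
  · have := sub_nonneg.2 huk
    positivity

lemma conic_nonneg_of_projForm_nonneg {d k u p q : ℝ} (hk : 0 < k) (hu : 0 ≤ u) (huk : u ≤ k)
    (h₁ : 0 ≤ (1 - p - q) / d + q) (h₂ : 0 < (1 - p - q) / d - q)
    (h : ∀ c e, 0 ≤ projForm d k u c e p q) : 0 ≤ conic d k u p q := by
  have hD := weight_pos hk hu huk (a := (1 - p - q) / d) (by linarith) h₂
  have := mul_nonneg hD.le (h ((1 - p - q) / d) ((1 - p - q) / d - q))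
  rw [projForm_mul_eq, mul_comm (_ - q), sub_self, zero_pow two_ne_zero, mul_zero, zero_add] at this
  exact nonneg_of_mul_nonneg_left this (by positivity)

lemma projForm_nonneg_of_conic_nonneg {d k u p q : ℝ} (hk : 0 < k) (hu : 0 ≤ u) (huk : u ≤ k)
    (h₁ : 0 ≤ (1 - p - q) / d + q) (h₂ : 0 < (1 - p - q) / d - q)
    (h : 0 ≤ conic d k u p q) (c e : ℝ) : 0 ≤ projForm d k u c e p q := by
  have hD := weight_pos hk hu huk (a := (1 - p - q) / d) (by linarith) h₂
  refine nonneg_of_mul_nonneg_right ?_ hD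
  have := sub_nonneg.2 huk
  rw [projForm_mul_eq]
  positivity

lemma mem_projRegion_iff {d k r R p q : ℝ} (hr : 0 ≤ r) (hrk : r ≤ k) (hR : 0 < R) (hRk : R ≤ k) :
    (p, q) ∈ projRegion d k r R ↔ 0 ≤ (1 - p - q) / d + q ∧ 0 ≤ (1 - p - q) / d - q ∧
      (0 ≤ p ∨ 0 < (1 - p - q) / d - q ∧ 0 ≤ conic d k r p q ∧ 0 ≤ conic d k R p q) := by
  have hk : 0 < k := hR.trans_le hRk
  constructor
  · rintro ⟨h₁, h₂, h₃, h₄⟩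
    refine ⟨h₁, h₂, (le_or_gt 0 p).imp_right fun hp => ?_⟩
    -- The test (c, e) = (1, 0) gives a - q + pR ≥ 0, and p < 0 makes the inequality a > q strict.
    have hb : 0 < (1 - p - q) / d - q := by
      have := h₄ 1 0
      simp only [projForm] at this
      have h5 : 0 ≤ R * ((1 - p - q) / d - q + p * R) := by linarith
      have := nonneg_of_mul_nonneg_right h5 hR
      nlinarith
    exact ⟨hb, conic_nonneg_of_projForm_nonneg hk hr hrk h₁ hb h₃,
      conic_nonneg_of_projForm_nonneg hk hR.le hRk h₁ hb h₄⟩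
  · rintro ⟨h₁, h₂, hp | ⟨hb, h₃, h₄⟩⟩
    · exact ⟨h₁, h₂, projForm_nonneg_of_nonneg hr hrk h₁ h₂ hp,
        projForm_nonneg_of_nonneg hR.le hRk h₁ h₂ hp⟩
    · exact ⟨h₁, h₂, projForm_nonneg_of_conic_nonneg hk hr hrk h₁ hb h₃,
        projForm_nonneg_of_conic_nonneg hk hR.le hRk h₁ hb h₄⟩

/-- Affineness in u reduces an interval of parameters to its two ends; the sign of the slope pq
tells which end is binding. -/
lemma conic_eq_add (d k u v p q : ℝ) :
    conic d k v p q = conic d k u p q + (v - u) * (p * q) := by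
  rw [conic, conic]
  ring

/-- This is the weighted Cauchy-Schwarz inequality (√(rα) + √(nm))² ≤ (r/b + n/a)(bα + am), cleared
of denominators. -/
lemma mul_sq_le_of_sq_le {a b r n α m t t₁ t₂ : ℝ} (ha : 0 ≤ a) (hb : 0 ≤ b)
    (hr : 0 ≤ r) (hn : 0 ≤ n) (hα : 0 ≤ α) (hm : 0 ≤ m) (h₁ : t₁ ^ 2 ≤ r * α)
    (h₂ : t₂ ^ 2 ≤ n * m) (ht : 0 ≤ t) (htt : t ≤ t₁ + t₂) :
    a * b * t ^ 2 ≤ (r * a + n * b) * (b * α + a * m) := by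
  have hsq : t ^ 2 ≤ (t₁ + t₂) ^ 2 := by gcongr
  have key : 2 * (a * b * (t₁ * t₂)) ≤ a ^ 2 * r * m + b ^ 2 * n * α := by
    refine abs_le_of_sq_le_sq' ?_ (by positivity) |>.2
    have : t₁ ^ 2 * t₂ ^ 2 ≤ (r * α) * (n * m) :=
      mul_le_mul h₁ h₂ (sq_nonneg _) (by positivity)
    have h4 : (a * b) ^ 2 * (t₁ ^ 2 * t₂ ^ 2) ≤ (a * b) ^ 2 * ((r * α) * (n * m)) := by gcongr
    nlinarith [sq_nonneg (a ^ 2 * r * m - b ^ 2 * n * α)]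
  have hab : 0 ≤ a * b := by positivity
  have e1 := mul_le_mul_of_nonneg_left hsq hab
  have e2 := mul_le_mul_of_nonneg_left h₁ hab
  have e3 := mul_le_mul_of_nonneg_left h₂ hab
  linarith

lemma form_nonneg_of_mem_projRegion {d k r R p q s : ℝ} (hr : 0 ≤ r) (hR : 0 < R)
    (hRk : R ≤ k) (hrs : r ≤ s) (hsR : s ≤ R) (h : (p, q) ∈ projRegion d k r R)
    {σ α m t t₁ t₂ : ℝ} (hσ : 0 ≤ σ) (hα : 0 ≤ α) (hm : 0 ≤ m)
    (h₁ : t₁ ^ 2 ≤ s * α) (h₂ : t₂ ^ 2 ≤ (k - s) * m) (ht : 0 ≤ t) (htt : t ≤ t₁ + t₂) :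
    0 ≤ (1 - p - q) / d * (σ + α + m) + p * t ^ 2 + q * (σ - α) := by
  rw [mem_projRegion_iff hr (by linarith) hR hRk] at h
  have hs : conic d k s p q = _ := conic_eq_add d k r s p q
  have hs' : conic d k s p q = _ := conic_eq_add d k R s p q
  have hexp : conic d k s p q = (1 - p - q) / d * ((1 - p - q) / d - q)
      + p * (s * ((1 - p - q) / d) + (k - s) * ((1 - p - q) / d - q)) := by rw [conic]; ring
  generalize (1 - p - q) / d = a at h hexp ⊢
  obtain ⟨ha₁, ha₂, hp | ⟨hb, hcr, hcR⟩⟩ := h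
  · nlinarith [mul_nonneg ha₁ hσ, mul_nonneg ha₂ hα, mul_nonneg (add_nonneg ha₁ ha₂) hm,
      mul_nonneg hp (sq_nonneg t)]
  · have ha : 0 < a := by linarith
    have hcs : 0 ≤ conic d k s p q := by
      rcases le_total 0 (p * q) with hpq | hpq
      · nlinarith [mul_nonneg (sub_nonneg.2 hrs) hpq]
      · nlinarith [mul_nonneg_of_nonpos_of_nonpos (sub_nonpos.2 hsR) hpq]
    rcases le_or_gt 0 p with hp | hp
    · nlinarith [mul_nonneg ha₁ hσ, mul_nonneg hb.le hα, mul_nonneg ha.le hm,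
        mul_nonneg hp (sq_nonneg t)]
    have key := mul_sq_le_of_sq_le ha.le hb.le (hr.trans hrs) (by linarith : 0 ≤ k - s) hα hm h₁ h₂
      ht htt
    have hX : 0 ≤ (a - q) * α + a * m := by positivity
    -- Since p < 0, `key` bounds this product below by `conic` at s times (a - q)α + am.
    have e1 : 0 ≤ a * (a - q) * ((a - q) * α + a * m + p * t ^ 2) := by
      have := mul_le_mul_of_nonneg_left key (neg_nonneg.2 hp.le)
      have e2 := mul_nonneg (hexp ▸ hcs) hX
      nlinarith
    have := nonneg_of_mul_nonneg_right e1 (by positivity)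
    nlinarith [mul_nonneg ha₁ hσ]

/-- The characterization of `k`-positivity of `sympMap d p q` by finitely many quadratic forms. -/
theorem kPosRegion_eq_projRegion {d k r R : ℕ} (hd : 4 ≤ d) (he : Even d) (hk : 1 < k) (hkd : k < d)
    (hr : r = 2 * k - d) (hR : R = if Even k then k else k - 1) :
    kPosRegion d k = projRegion d k r R := by
  have hRe : Even R := by
    rw [hR]; split_ifs with h
    · exact h
    · exact Nat.Odd.sub_odd (Nat.not_even_iff_odd.1 h) odd_one
  have hre : Even r := by
    rw [hr]
    rcases le_total (2 * k) d with h | h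
    · rw [Nat.sub_eq_zero_of_le h]; exact Even.zero
    · exact (Nat.even_sub h).2 (by simp [he])
  have hRk : R ≤ k := by rw [hR]; split_ifs <;> omega
  have hR0 : 0 < R := by rw [hR]; split_ifs <;> omega
  have hRd : 2 * k ≤ d + R := by
    obtain ⟨m, rfl⟩ := he
    rw [hR]
    split_ifs with h
    · omega
    · obtain ⟨n, rfl⟩ := Nat.not_even_iff_odd.1 h
      omega
  ext ⟨p, q⟩
  constructor
  · intro h
    exact ⟨h.nonneg_add hd he (by omega) hkd.le, h.nonneg_sub hd he hk hkd.le,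
      h.projForm_nonneg hd he hkd.le hre (by omega) (by omega),
      h.projForm_nonneg hd he hkd.le hRe hRk hRd⟩
  · intro h
    refine (isKPositive_sympMap_iff (by omega) p q).2 fun W V => ?_
    obtain ⟨σ, α, m, s, t₁, t₂, t, hσ, hα, hm, hs0, hs, hsk, hodd, h₁, h₂, ht, htt, heq⟩ :=
      sympForm_mul_conjTranspose_eq (by omega) he hkd.le p q W V
    rw [heq]
    -- Truncated subtraction makes r equal to max(0, 2k - d).
    have hrs : (r : ℝ) ≤ s := by
      rw [hr]
      rcases le_total (2 * k) d with h | h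
      · simpa [Nat.sub_eq_zero_of_le h] using hs0
      · rw [Nat.cast_sub h]
        push_cast
        exact hs
    have hsR : s ≤ R := by
      rw [hR]
      split_ifs with h
      · exact hsk
      · rw [Nat.cast_sub (by omega)]
        simpa using hodd (Nat.not_even_iff_odd.1 h)
    exact_mod_cast form_nonneg_of_mem_projRegion (by positivity) (by exact_mod_cast hR0)
      (by exact_mod_cast hRk) hrs hsR h hσ hα hm h₁ h₂ ht htt

/-! ### Rational parametrization of the conics. -/

/-- The parameter constraints under which the convex geometry of `projRegion` is described. -/
structure RegionParams (d k r R : ℝ) : Prop where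
  four_le : 4 ≤ d
  two_le : 2 ≤ k
  nonneg : 0 ≤ r
  le : r ≤ R
  le_top : R ≤ k
  lt_top : r < k
  one_le : 1 ≤ R

/-- The denominator `k - (k - u) t`. -/
noncomputable def hypWeight (k u t : ℝ) : ℝ := k - (k - u) * t

/-- The denominator in the rational parametrization of the conic. -/
noncomputable def hypDenom (d k u t : ℝ) : ℝ := (d + t) * hypWeight k u t - (1 - t)

/-- The rational parametrization of the conic by `t = q / a`, where `a = (1 - p - q) / d`. -/
noncomputable def hypPoint (d k u t : ℝ) : ℝ × ℝ :=
  (-(1 - t) / hypDenom d k u t, t * hypWeight k u t / hypDenom d k u t)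

section hypPoint

variable {d k u t p q : ℝ}

/-- For u = 0 the weight is k(1 - t), which vanishes at t = 1; the disjunction excludes this case,
as u = 0 is only needed for t ≤ 0. -/
lemma hypWeight_pos (hk : 0 < k) (huk : u ≤ k) (ht : t ≤ 1) (h : 0 < u ∨ t ≤ 0) :
    0 < hypWeight k u t := by
  rw [hypWeight]
  rcases le_or_gt t 0 with h0 | h0
  · nlinarith [mul_nonneg (sub_nonneg.2 huk) (neg_nonneg.2 h0)]
  · have hu' : 0 < u := h.resolve_right (not_le.2 h0)
    nlinarith [mul_pos hu' h0, mul_nonneg hk.le (sub_nonneg.2 ht)]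

lemma hypDenom_pos (hd : 4 ≤ d) (hk : 2 ≤ k) (hu : 0 ≤ u) (huk : u ≤ k) (ht : t ≤ 1) (ht' : -1 ≤ t)
    (h : 0 < u ∨ t ≤ 0) : 0 < hypDenom d k u t := by
  have hw := hypWeight_pos (by linarith) huk ht h
  have h1 : 1 - t ≤ hypWeight k u t := by
    rw [hypWeight]
    rcases le_or_gt t 0 with h0 | h0
    · nlinarith [mul_nonneg (sub_nonneg.2 huk) (neg_nonneg.2 h0)]
    · nlinarith [mul_nonneg hu h0.le]
  rw [hypDenom]
  nlinarith

lemma hypPoint_coord (hd : d ≠ 0) (hN : hypDenom d k u t ≠ 0) :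
    (1 - (hypPoint d k u t).1 - (hypPoint d k u t).2) / d =
      hypWeight k u t / hypDenom d k u t := by
  simp only [hypPoint]
  field_simp
  rw [hypDenom]
  ring

lemma hypPoint_snd (hd : d ≠ 0) (hN : hypDenom d k u t ≠ 0) :
    (hypPoint d k u t).2 = t * ((1 - (hypPoint d k u t).1 - (hypPoint d k u t).2) / d) := by
  rw [hypPoint_coord hd hN, hypPoint]
  ring

lemma hypPoint_rel (hd : d ≠ 0) (hN : hypDenom d k u t ≠ 0) :
    (1 - (hypPoint d k u t).1 - (hypPoint d k u t).2) / d * (1 - t) +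
      (hypPoint d k u t).1 * hypWeight k u t = 0 := by
  rw [hypPoint_coord hd hN, hypPoint]
  ring

lemma conic_hypPoint (hd : d ≠ 0) (hN : hypDenom d k u t ≠ 0) :
    conic d k u (hypPoint d k u t).1 (hypPoint d k u t).2 = 0 := by
  have h1 := hypPoint_snd hd hN
  have h2 := hypPoint_rel hd hN
  rw [conic]
  generalize (1 - (hypPoint d k u t).1 - (hypPoint d k u t).2) / d = a at *
  rw [hypWeight] at h2
  rw [h1]
  linear_combination a * h2

/-- On q = ta the critical direction (a, a - q) is proportional to (1, 1 - t), so this `projForm`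
gives the supporting line at parameter t. -/
lemma projForm_hypPoint (hd : d ≠ 0) (hN : hypDenom d k u t ≠ 0) :
    projForm d k u 1 (1 - t) (hypPoint d k u t).1 (hypPoint d k u t).2 = 0 := by
  have h1 := hypPoint_snd hd hN
  have h2 := hypPoint_rel hd hN
  rw [projForm]
  generalize (1 - (hypPoint d k u t).1 - (hypPoint d k u t).2) / d = a at *
  rw [hypWeight] at h2
  rw [h1]
  linear_combination (k - (k - u) * t) * h2

lemma eq_hypPoint (hd : d ≠ 0) (hN : hypDenom d k u t ≠ 0) (hw : hypWeight k u t ≠ 0)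
    (h₁ : q = t * ((1 - p - q) / d))
    (h₂ : (1 - p - q) / d * (1 - t) + p * hypWeight k u t = 0) :
    (p, q) = hypPoint d k u t := by
  have h3 : d * ((1 - p - q) / d) + p + q = 1 := by field_simp; ring
  generalize (1 - p - q) / d = a at *
  have ha : a * hypDenom d k u t = hypWeight k u t := by
    rw [hypDenom]
    linear_combination hypWeight k u t * h3 - h₂ - hypWeight k u t * h₁
  ext
  · simp only [hypPoint]
    rw [eq_div_iff hN]
    refine mul_left_cancel₀ hw ?_
    linear_combination hypDenom d k u t * h₂ - (1 - t) * ha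
  · simp only [hypPoint]
    rw [eq_div_iff hN, h₁]
    linear_combination t * ha

/-- After substituting q = ta the conic equation has the factor a > 0, and what remains is linear in
a and p. -/
lemma eq_hypPoint_of_conic_eq_zero (hd : 4 ≤ d) (hk : 2 ≤ k) (hu : 0 ≤ u) (huk : u ≤ k)
    (h₁ : 0 ≤ (1 - p - q) / d + q) (h₂ : 0 ≤ (1 - p - q) / d - q) (ha : 0 < (1 - p - q) / d)
    (h : 0 < u ∨ q ≤ 0) (hc : conic d k u p q = 0) :
    (p, q) = hypPoint d k u (q / ((1 - p - q) / d)) := by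
  have hq : q = q / ((1 - p - q) / d) * ((1 - p - q) / d) :=
    (div_mul_cancel₀ _ ha.ne').symm
  have ht : q / ((1 - p - q) / d) ≤ 1 := by rw [div_le_one ha]; linarith
  have ht' : -1 ≤ q / ((1 - p - q) / d) := by rw [le_div_iff₀ ha]; linarith
  have h' : 0 < u ∨ q / ((1 - p - q) / d) ≤ 0 :=
    h.imp_right fun h => div_nonpos_of_nonpos_of_nonneg h ha.le
  refine eq_hypPoint (by positivity) (hypDenom_pos hd hk hu huk ht ht' h').ne'
    (hypWeight_pos (by linarith) huk ht h').ne' hq ?_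
  rw [hypWeight]
  rw [conic] at hc
  refine mul_left_cancel₀ ha.ne' ?_
  generalize q / ((1 - p - q) / d) = t at *
  generalize (1 - p - q) / d = a at *
  rw [hq] at hc
  linear_combination hc

lemma hypPoint_one (hd : 4 ≤ d) (hu : 0 < u) :
    hypPoint d k u 1 = (0, 1 / (d + 1)) := by
  have : d + 1 ≠ 0 := by positivity
  simp [hypPoint, hypDenom, hypWeight]
  field_simp

lemma hypPoint_zero : hypPoint d k u 0 = (-1 / (k * d - 1), 0) := by
  simp [hypPoint, hypDenom, hypWeight, mul_comm]

lemma hypPoint_neg_one : hypPoint d k u (-1) =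
    (-2 / (d * (2 * k - u) - (2 * k - u) - 2),
      -(2 * k - u) / (d * (2 * k - u) - (2 * k - u) - 2)) := by
  have : hypDenom d k u (-1) = d * (2 * k - u) - (2 * k - u) - 2 := by
    rw [hypDenom, hypWeight]; ring
  rw [hypPoint, this, hypWeight]
  ext <;> simp only <;> ring

lemma hypPoint_injOn (hd : 4 ≤ d) (hk : 2 ≤ k) (hu : 0 ≤ u) (huk : u ≤ k) {t t' : ℝ}
    (ht : t ≤ 1) (ht' : -1 ≤ t) (h : 0 < u ∨ t ≤ 0) (hs : t' ≤ 1) (hs' : -1 ≤ t')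
    (h' : 0 < u ∨ t' ≤ 0) (heq : hypPoint d k u t = hypPoint d k u t') : t = t' := by
  have hN := hypDenom_pos hd hk hu huk ht ht' h
  have hN' := hypDenom_pos hd hk hu huk hs hs' h'
  have hd0 : d ≠ 0 := by positivity
  have e1 := hypPoint_snd hd0 hN.ne'
  have e2 := hypPoint_snd hd0 hN'.ne'
  have e3 := hypPoint_coord hd0 hN.ne'
  rw [← heq] at e2
  replace e2 := e1.symm.trans e2
  rw [e3] at e2
  have hw := hypWeight_pos (by linarith) huk ht h
  exact mul_right_cancel₀ (by positivity) e2

end hypPoint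

/-- The value x = 1 serves the arc ending at C, and x = 0 the arc starting there. The path lowers t
from x to x - 1; injectivity holds because t is recovered as q/a. -/
lemma isArcOf_hypPoint {d k : ℕ} (hd : 4 ≤ d) (hk : 2 ≤ k) {u x : ℝ} (hu : 0 ≤ u) (huk : u ≤ k)
    (hx : x ≤ 1) (hx' : 0 ≤ x) (h : 0 < u ∨ x = 0) :
    IsArcOf (fCurve d k u) (hypPoint d k u x) (hypPoint d k u (x - 1))
      (hypPoint d k u '' Set.Icc (x - 1) x) := by
  have hd' : (4 : ℝ) ≤ d := by exact_mod_cast hd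
  have hk' : (2 : ℝ) ≤ k := by exact_mod_cast hk
  have hdis : ∀ t ≤ x, 0 < u ∨ t ≤ 0 := fun t ht => h.imp_right fun h => by linarith
  have hN : ∀ τ : unitInterval, 0 < hypDenom d k u (x - τ) := fun τ =>
    hypDenom_pos hd' hk' hu huk (by linarith [τ.2.1]) (by linarith [τ.2.2])
      (hdis _ (by linarith [τ.2.1]))
  refine ⟨?_, ⟨⟨⟨fun τ => hypPoint d k u (x - τ), ?_⟩, ?_, ?_⟩, ?_, ?_⟩⟩
  · rintro _ ⟨t, ⟨ht, ht'⟩, rfl⟩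
    have := hypDenom_pos hd' hk' hu huk (t := t) (by linarith) (by linarith) (hdis _ ht')
    change fQuad _ _ _ _ _ = 0
    rw [fQuad_eq_conic (by omega), conic_hypPoint (by positivity) this.ne', mul_zero]
  · refine Continuous.prodMk (Continuous.div ?_ ?_ fun τ => (hN τ).ne')
      (Continuous.div ?_ ?_ fun τ => (hN τ).ne') <;>
    (try simp only [hypDenom, hypWeight]) <;> fun_prop
  · simp
  · simp
  · intro τ τ' hττ
    have := hypPoint_injOn hd' hk' hu huk (by linarith [τ.2.1]) (by linarith [τ.2.2])
      (hdis _ (by linarith [τ.2.1])) (by linarith [τ'.2.1]) (by linarith [τ'.2.2])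
      (hdis _ (by linarith [τ'.2.1])) hττ
    ext
    linarith
  · ext z
    constructor
    · rintro ⟨τ, rfl⟩
      exact ⟨x - τ, ⟨by linarith [τ.2.2], by linarith [τ.2.1]⟩, rfl⟩
    · rintro ⟨t, ⟨ht, ht'⟩, rfl⟩
      refine ⟨⟨x - t, by linarith, by linarith⟩, ?_⟩
      change hypPoint d k u (x - (x - t)) = _
      rw [sub_sub_cancel]

/-! ### Supporting lines and the boundary. -/

/-- The affine function is positive at the origin and zero at z, hence negative at sz for s > 1, so
such points lie outside S. -/
lemma mem_frontier_of_affine_nonneg {S : Set (ℝ × ℝ)} (hS : IsClosed S) {z : ℝ × ℝ} (hz : z ∈ S)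
    {c₀ c₁ c₂ : ℝ} (h₀ : 0 < c₀) (h : ∀ y ∈ S, 0 ≤ c₀ + c₁ * y.1 + c₂ * y.2)
    (hz₀ : c₀ + c₁ * z.1 + c₂ * z.2 = 0) : z ∈ frontier S := by
  rw [hS.frontier_eq]
  refine ⟨hz, fun hint => ?_⟩
  have hcont : Filter.Tendsto (fun s : ℝ => s • z) (nhds 1) (nhds z) := by
    have : Continuous fun s : ℝ => s • z := by fun_prop
    simpa using this.tendsto 1
  have hev := hcont.eventually (mem_interior_iff_mem_nhds.1 hint)
  obtain ⟨s, hs, hs1⟩ := ((hev.filter_mono nhdsWithin_le_nhds).and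
    (self_mem_nhdsWithin (s := Set.Ioi (1 : ℝ)))).exists
  have := h _ hs
  have hs1 : 1 < s := hs1
  simp only [Prod.smul_fst, Prod.smul_snd, smul_eq_mul] at this
  nlinarith

lemma affine_eq_zero_of_mem_openSegment {c₀ c₁ c₂ : ℝ} {x y z : ℝ × ℝ}
    (hz : z ∈ openSegment ℝ x y) (hx : 0 ≤ c₀ + c₁ * x.1 + c₂ * x.2)
    (hy : 0 ≤ c₀ + c₁ * y.1 + c₂ * y.2) (hz₀ : c₀ + c₁ * z.1 + c₂ * z.2 = 0) :
    c₀ + c₁ * x.1 + c₂ * x.2 = 0 := by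
  obtain ⟨α, β, hα, hβ, hαβ, rfl⟩ := hz
  simp only [Prod.fst_add, Prod.snd_add, Prod.smul_fst, Prod.smul_snd, smul_eq_mul] at hz₀
  have h : α * (c₀ + c₁ * x.1 + c₂ * x.2) + β * (c₀ + c₁ * y.1 + c₂ * y.2) = 0 := by
    linear_combination hz₀ + c₀ * hαβ
  have := mul_nonneg hα.le hx
  have := mul_nonneg hβ.le hy
  exact (mul_eq_zero.1 (by linarith : α * (c₀ + c₁ * x.1 + c₂ * x.2) = 0)).resolve_left hα.ne'

lemma projForm_eq_affine (d k u c e p q : ℝ) :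
    projForm d k u c e p q = (u * c ^ 2 + (k - u) * e ^ 2) / d
      + ((u * c + (k - u) * e) ^ 2 - (u * c ^ 2 + (k - u) * e ^ 2) / d) * p
      + (-(u * c ^ 2 + (k - u) * e ^ 2) / d - u * c ^ 2) * q := by
  rw [projForm]
  ring

lemma isClosed_projRegion (d k r R : ℝ) : IsClosed (projRegion d k r R) := by
  have h : ∀ u, IsClosed {z : ℝ × ℝ | ∀ c e, 0 ≤ projForm d k u c e z.1 z.2} := fun u => by
    simp only [Set.ofPred_forall]
    refine isClosed_iInter fun c => isClosed_iInter fun e => isClosed_le continuous_const ?_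
    simp only [projForm_eq_affine]
    fun_prop
  have h₁ : Continuous fun z : ℝ × ℝ => (1 - z.1 - z.2) / d + z.2 := by fun_prop
  have h₂ : Continuous fun z : ℝ × ℝ => (1 - z.1 - z.2) / d - z.2 := by fun_prop
  exact (isClosed_le continuous_const h₁).inter
    ((isClosed_le continuous_const h₂).inter ((h r).inter (h R)))

namespace RegionParams

variable {d k r R : ℝ} (H : RegionParams d k r R)

include H

lemma mem_iff {p q : ℝ} :
    (p, q) ∈ projRegion d k r R ↔ 0 ≤ (1 - p - q) / d + q ∧ 0 ≤ (1 - p - q) / d - q ∧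
      (0 ≤ p ∨ 0 < (1 - p - q) / d - q ∧ 0 ≤ conic d k r p q ∧ 0 ≤ conic d k R p q) :=
  mem_projRegion_iff H.nonneg H.lt_top.le (by linarith [H.one_le]) H.le_top

lemma hypPoint_mem_of_nonneg {t : ℝ} (ht : 0 ≤ t) (ht' : t ≤ 1) :
    hypPoint d k R t ∈ projRegion d k r R := by
  have := H.four_le; have := H.two_le; have := H.one_le; have := H.le_top; have := H.le
  have hN := hypDenom_pos (d := d) (k := k) (u := R) (t := t) (by linarith) (by linarith)
    (by linarith) (by linarith) ht' (by linarith) (Or.inl (by linarith))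
  have hw := hypWeight_pos (k := k) (u := R) (t := t) (by linarith) (by linarith) ht'
    (Or.inl (by linarith))
  have hd0 : d ≠ 0 := by linarith
  have e1 := hypPoint_coord hd0 hN.ne'
  have e2 := hypPoint_snd hd0 hN.ne'
  have e3 := conic_hypPoint hd0 hN.ne'
  have e4 := conic_eq_add d k R r (hypPoint d k R t).1 (hypPoint d k R t).2
  have e5 : (hypPoint d k R t).1 = -(1 - t) / hypDenom d k R t := rfl
  have ha : 0 < hypWeight k R t / hypDenom d k R t := by positivity
  have hp : (hypPoint d k R t).1 ≤ 0 :=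
    e5 ▸ div_nonpos_of_nonpos_of_nonneg (by linarith) hN.le
  generalize hypPoint d k R t = z at *
  obtain ⟨p, q⟩ := z
  simp only at *
  rw [e1] at e2
  refine H.mem_iff.2 ⟨?_, ?_, (le_or_gt 0 p).imp_right fun hp' => ⟨?_, ?_, e3.ge⟩⟩
  · rw [e1]; nlinarith
  · rw [e1]; nlinarith
  · have ht1 : t < 1 := by
      by_contra! h1
      have : t = 1 := le_antisymm ht' h1
      rw [e5, this] at hp'
      simp at hp'
    rw [e1]; nlinarith
  · have : p * q ≤ 0 := mul_nonpos_of_nonpos_of_nonneg hp (by rw [e2]; positivity)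
    nlinarith

lemma hypPoint_mem_of_nonpos {t : ℝ} (ht : -1 ≤ t) (ht' : t ≤ 0) :
    hypPoint d k r t ∈ projRegion d k r R := by
  have := H.four_le; have := H.two_le; have := H.nonneg; have := H.lt_top; have := H.le
  have hN := hypDenom_pos (d := d) (k := k) (u := r) (t := t) (by linarith) (by linarith)
    (by linarith) (by linarith) (by linarith) (by linarith) (Or.inr (by linarith))
  have hw := hypWeight_pos (k := k) (u := r) (t := t) (by linarith) (by linarith) (by linarith)
    (Or.inr (by linarith))
  have hd0 : d ≠ 0 := by linarith
  have e1 := hypPoint_coord hd0 hN.ne'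
  have e2 := hypPoint_snd hd0 hN.ne'
  have e3 := conic_hypPoint hd0 hN.ne'
  have e4 := conic_eq_add d k r R (hypPoint d k r t).1 (hypPoint d k r t).2
  have e5 : (hypPoint d k r t).1 = -(1 - t) / hypDenom d k r t := rfl
  have ha : 0 < hypWeight k r t / hypDenom d k r t := by positivity
  have hp : (hypPoint d k r t).1 ≤ 0 :=
    e5 ▸ div_nonpos_of_nonpos_of_nonneg (by linarith) hN.le
  generalize hypPoint d k r t = z at *
  obtain ⟨p, q⟩ := z
  simp only at *
  rw [e1] at e2
  refine H.mem_iff.2 ⟨?_, ?_, Or.inr ⟨?_, e3.ge, ?_⟩⟩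
  · rw [e1]; nlinarith
  · rw [e1]; nlinarith
  · rw [e1]; nlinarith
  · have : 0 ≤ p * q := mul_nonneg_of_nonpos_of_nonpos hp (by rw [e2]; nlinarith)
    nlinarith

lemma vertexA_mem : (1, 0) ∈ projRegion d k r R := H.mem_iff.2 (by norm_num)

lemma segment_AB_subset {z : ℝ × ℝ} (hz : z ∈ segment ℝ (1, 0) (hypPoint d k R 1)) :
    z ∈ projRegion d k r R ∧ (1 - z.1 - z.2) / d - z.2 = 0 := by
  have := H.four_le; have := H.one_le
  rw [hypPoint_one H.four_le (by linarith)] at hz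
  obtain ⟨α, β, hα, hβ, hαβ, rfl⟩ := hz
  have hq : (1 - α - β * (1 / (d + 1))) / d = β * (1 / (d + 1)) := by
    rw [show 1 - α = β by linarith]
    field_simp
    ring
  have hb : 0 ≤ β * (1 / (d + 1)) := by positivity
  simp only [Prod.smul_mk, smul_eq_mul, mul_one, mul_zero, Prod.mk_add_mk, add_zero, zero_add]
  refine ⟨H.mem_iff.2 ⟨?_, ?_, Or.inl hα⟩, ?_⟩ <;> rw [hq] <;> linarith

lemma mem_segment_AB {p q : ℝ} (hp : 0 ≤ p) (hq : 0 ≤ q) (h : (1 - p - q) / d = q) :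
    (p, q) ∈ segment ℝ (1, 0) (hypPoint d k R 1) := by
  have := H.four_le; have := H.one_le
  rw [hypPoint_one H.four_le (by linarith)]
  rw [div_eq_iff (by linarith)] at h
  have h1 : q = (1 - p) * (1 / (d + 1)) := by
    field_simp
    linarith
  refine ⟨p, 1 - p, hp, by nlinarith, by ring, ?_⟩
  simp only [Prod.smul_mk, smul_eq_mul, mul_one, mul_zero, Prod.mk_add_mk, add_zero, zero_add]
  rw [h1]

lemma vertexE_denom_pos : 0 < d * (2 * k - r) - (2 * k - r) - 2 := by
  have := H.four_le; have := H.two_le; have := H.lt_top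
  nlinarith

/-- The first end point is D when r = 0 and E when r = 2k - d; both cases are treated together. -/
lemma segment_EA_subset {z : ℝ × ℝ} (hz : z ∈ segment ℝ (hypPoint d k r (-1)) (1, 0)) :
    z ∈ projRegion d k r R ∧ (1 - z.1 - z.2) / d + z.2 = 0 := by
  have hD := H.vertexE_denom_pos
  have := H.four_le; have := H.two_le; have := H.lt_top; have := H.le
  rw [hypPoint_neg_one] at hz
  obtain ⟨α, β, hα, hβ, hαβ, rfl⟩ := hz
  simp only [Prod.smul_mk, smul_eq_mul, mul_one, mul_zero, Prod.mk_add_mk, add_zero]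
  set D := d * (2 * k - r) - (2 * k - r) - 2 with hDdef
  have ha : (1 - (α * (-2 / D) + β) - α * (-(2 * k - r) / D)) / d = α * (2 * k - r) / D := by
    rw [show 1 - (α * (-2 / D) + β) - α * (-(2 * k - r) / D) =
      α * (D + 2 + (2 * k - r)) / D by rw [← hαβ]; field_simp; ring, hDdef]
    field_simp
    ring
  have hq : α * (-(2 * k - r) / D) = -(α * (2 * k - r) / D) := by ring
  have hp : α * (-2 / D) * (2 * k - r) = -(2 * (α * (2 * k - r) / D)) := by ring
  have hx : 0 < 2 * k - r := by linarith
  have ha0 : 0 ≤ α * (2 * k - r) / D := by positivity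
  refine ⟨H.mem_iff.2 ?_, by rw [ha, hq]; ring⟩
  have e4 := conic_eq_add d k r R (α * (-2 / D) + β) (α * (-(2 * k - r) / D))
  have e5 : conic d k r (α * (-2 / D) + β) (α * (-(2 * k - r) / D)) =
      α * (2 * k - r) / D * ((2 * k - r) * β) := by
    rw [conic, ha, hq]
    linear_combination (α * (2 * k - r) / D) * hp
  rw [ha, hq]
  refine ⟨by linarith, by linarith, (le_or_gt 0 _).imp_right fun hneg => ?_⟩
  have hα0 : 0 < α := by
    rcases hα.eq_or_lt with h | h
    · rw [← h] at hneg; linarith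
    · exact h
  have ha1 : 0 < α * (2 * k - r) / D := by positivity
  rw [hq] at e4 e5
  have e6 : 0 ≤ conic d k r (α * (-2 / D) + β) (-(α * (2 * k - r) / D)) := by
    rw [e5]; positivity
  refine ⟨by linarith, e6, ?_⟩
  have : 0 ≤ (α * (-2 / D) + β) * -(α * (2 * k - r) / D) :=
    mul_nonneg_of_nonpos_of_nonpos hneg.le (by linarith)
  have := mul_nonneg (sub_nonneg.2 H.le) this
  linarith

lemma mem_segment_EA {p q : ℝ} (hq : q ≤ 0) (h : (1 - p - q) / d = -q)
    (hp : 0 ≤ -(2 * q) + p * (2 * k - r)) :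
    (p, q) ∈ segment ℝ (hypPoint d k r (-1)) (1, 0) := by
  have hD := H.vertexE_denom_pos
  have := H.four_le; have := H.two_le; have := H.lt_top
  have hx : 0 < 2 * k - r := by linarith
  rw [div_eq_iff (by linarith)] at h
  rw [hypPoint_neg_one]
  set D := d * (2 * k - r) - (2 * k - r) - 2 with hDdef
  refine ⟨-q * D / (2 * k - r), 1 + q * D / (2 * k - r), ?_, ?_, by ring, ?_⟩
  · have := neg_nonneg.2 hq
    positivity
  · rw [← mul_nonneg_iff_of_pos_right hx, add_mul, div_mul_cancel₀ _ hx.ne', hDdef]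
    nlinarith
  · simp only [Prod.smul_mk, smul_eq_mul, mul_one, mul_zero, Prod.mk_add_mk, add_zero]
    ext <;> simp only
    · field_simp
      rw [hDdef]
      linear_combination (2 * k - r) * h
    · field_simp

lemma mem_interior {p q : ℝ} (h₁ : 0 < (1 - p - q) / d + q) (h₂ : 0 < (1 - p - q) / d - q)
    (h₃ : 0 < conic d k r p q) (h₄ : 0 < conic d k R p q) :
    (p, q) ∈ interior (projRegion d k r R) := by
  have ho : IsOpen {z : ℝ × ℝ | (0 < (1 - z.1 - z.2) / d + z.2 ∧ 0 < (1 - z.1 - z.2) / d - z.2) ∧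
      0 < conic d k r z.1 z.2 ∧ 0 < conic d k R z.1 z.2} := by
    have c₁ : Continuous fun z : ℝ × ℝ => (1 - z.1 - z.2) / d + z.2 := by fun_prop
    have c₂ : Continuous fun z : ℝ × ℝ => (1 - z.1 - z.2) / d - z.2 := by fun_prop
    have c₃ : ∀ u, Continuous fun z : ℝ × ℝ => conic d k u z.1 z.2 := fun u => by
      simp only [conic]
      fun_prop
    exact ((isOpen_lt continuous_const c₁).inter (isOpen_lt continuous_const c₂)).inter
      ((isOpen_lt continuous_const (c₃ r)).inter (isOpen_lt continuous_const (c₃ R)))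
  refine interior_maximal ?_ ho (show _ ∈ {z : ℝ × ℝ | _} from ⟨⟨h₁, h₂⟩, h₃, h₄⟩)
  rintro ⟨x, y⟩ ⟨⟨g₁, g₂⟩, g₃, g₄⟩
  exact H.mem_iff.2 ⟨g₁.le, g₂.le, Or.inr ⟨g₂, g₃.le, g₄.le⟩⟩

lemma projForm_frontier {u c e : ℝ}
    (hce : 0 < u * c ^ 2 + (k - u) * e ^ 2) {z : ℝ × ℝ} (hz : z ∈ projRegion d k r R)
    (hform : ∀ y ∈ projRegion d k r R, 0 ≤ projForm d k u c e y.1 y.2)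
    (hz₀ : projForm d k u c e z.1 z.2 = 0) : z ∈ frontier (projRegion d k r R) := by
  have := H.four_le
  rw [projForm_eq_affine] at hz₀
  exact mem_frontier_of_affine_nonneg (isClosed_projRegion d k r R) hz (by positivity)
    (fun y hy => projForm_eq_affine d k u c e y.1 y.2 ▸ hform y hy) hz₀

/-- By `mem_interior`, some inequality is an equality at a boundary point. Off the two lines a = ±q
this forces p < 0; then the smaller conic value must vanish, which is that of R for q ≥ 0 and that
of r for q ≤ 0. Conversely each piece lies on supporting lines. -/
theorem frontier_eq : frontier (projRegion d k r R) =
    segment ℝ (1, 0) (hypPoint d k R 1) ∪ hypPoint d k R '' Set.Icc 0 1 ∪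
      hypPoint d k r '' Set.Icc (-1) 0 ∪ segment ℝ (hypPoint d k r (-1)) (1, 0) := by
  have := H.four_le; have := H.two_le; have := H.nonneg; have := H.lt_top; have := H.le
  have := H.one_le; have := H.le_top
  have hd0 : d ≠ 0 := by linarith
  apply Set.Subset.antisymm
  · rintro ⟨p, q⟩ hz
    rw [(isClosed_projRegion d k r R).frontier_eq] at hz
    obtain ⟨hz, hint⟩ := hz
    obtain ⟨h₁, h₂, h₃⟩ := H.mem_iff.1 hz
    have hint' := fun a b c d => hint (H.mem_interior a b c d)
    have hR := conic_eq_add d k r R p q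
    have hsum : d * ((1 - p - q) / d) + p + q = 1 := by field_simp; ring
    by_cases hb : (1 - p - q) / d - q = 0
    · refine Or.inl (Or.inl (Or.inl (H.mem_segment_AB ?_ (by linarith) (by linarith))))
      exact h₃.resolve_right fun h => h.1.ne' hb
    by_cases hc : (1 - p - q) / d + q = 0
    · refine Or.inr (H.mem_segment_EA (by linarith) (by linarith) ?_)
      rcases h₃ with hp | ⟨hb', hcr, -⟩
      · have : 0 ≤ p * (2 * k - r) := mul_nonneg hp (by linarith)
        linarith
      · rw [conic, show (1 - p - q) / d = -q by linarith] at hcr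
        have hq : 0 < -q := by linarith
        refine nonneg_of_mul_nonneg_right (?_ : 0 ≤ -q * _) hq
        linarith
    have hb' : 0 < (1 - p - q) / d - q := lt_of_le_of_ne h₂ (Ne.symm hb)
    have hc' : 0 < (1 - p - q) / d + q := lt_of_le_of_ne h₁ (Ne.symm hc)
    have ha : 0 < (1 - p - q) / d := by linarith
    have hconic : ∀ u, 0 ≤ u → u ≤ k → 0 ≤ p → 0 < conic d k u p q := by
      intro u hu huk hp
      have := weight_pos (by linarith) hu huk ha hb'
      have e : conic d k u p q = (1 - p - q) / d * ((1 - p - q) / d - q)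
        + p * (u * ((1 - p - q) / d) + (k - u) * ((1 - p - q) / d - q)) := by rw [conic]; ring
      rw [e]
      positivity
    rcases le_or_gt 0 p with hp | hp
    · exact absurd (hconic R (by linarith) H.le_top hp)
        (hint' hc' hb' (hconic r H.nonneg H.lt_top.le hp))
    obtain ⟨-, hcr, hcR⟩ := h₃.resolve_left (not_le.2 hp)
    rcases le_or_gt 0 q with hq | hq
    · have hpq : (R - r) * (p * q) ≤ 0 := mul_nonpos_of_nonneg_of_nonpos (by linarith)
        (mul_nonpos_of_nonpos_of_nonneg hp.le hq)
      have hR0 : conic d k R p q = 0 := by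
        by_contra hne
        have : 0 < conic d k R p q := lt_of_le_of_ne hcR (Ne.symm hne)
        exact hint' hc' hb' (by linarith) this
      rw [eq_hypPoint_of_conic_eq_zero H.four_le H.two_le (by linarith) H.le_top h₁ h₂ ha
        (Or.inl (by linarith)) hR0]
      refine Or.inl (Or.inl (Or.inr ⟨_, ⟨by positivity, ?_⟩, rfl⟩))
      rw [div_le_one ha]
      linarith
    · have hpq : 0 ≤ (R - r) * (p * q) := mul_nonneg (by linarith)
        (mul_nonneg_of_nonpos_of_nonpos hp.le hq.le)
      have hr0 : conic d k r p q = 0 := by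
        by_contra hne
        have : 0 < conic d k r p q := lt_of_le_of_ne hcr (Ne.symm hne)
        exact hint' hc' hb' this (by linarith)
      rw [eq_hypPoint_of_conic_eq_zero H.four_le H.two_le H.nonneg H.lt_top.le h₁ h₂ ha
        (Or.inr hq.le) hr0]
      refine Or.inl (Or.inr ⟨_, ⟨?_, div_nonpos_of_nonpos_of_nonneg hq.le ha.le⟩, rfl⟩)
      rw [le_div_iff₀ ha]
      linarith
  · rintro z (((hz | ⟨t, ⟨ht, ht'⟩, rfl⟩) | ⟨t, ⟨ht, ht'⟩, rfl⟩) | hz)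
    · obtain ⟨hz, h0⟩ := H.segment_AB_subset hz
      refine mem_frontier_of_affine_nonneg (isClosed_projRegion d k r R) hz
        (c₀ := 1 / d) (c₁ := -(1 / d)) (c₂ := -(1 / d) - 1) (by positivity) (fun y hy => ?_) ?_
      · have := hy.2.1
        calc (0 : ℝ) ≤ _ := this
          _ = _ := by ring
      · rw [← h0]; ring
    · refine H.projForm_frontier (u := R) (c := 1) (e := 1 - t) ?_
        (H.hypPoint_mem_of_nonneg ht ht') (fun y hy => hy.2.2.2 _ _)
        (projForm_hypPoint hd0 (hypDenom_pos H.four_le H.two_le (by linarith) H.le_top ht'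
          (by linarith) (Or.inl (by linarith))).ne')
      have : 0 ≤ k - R := by linarith
      positivity
    · refine H.projForm_frontier (u := r) (c := 1) (e := 1 - t) ?_
        (H.hypPoint_mem_of_nonpos ht ht') (fun y hy => hy.2.2.1 _ _)
        (projForm_hypPoint hd0 (hypDenom_pos H.four_le H.two_le H.nonneg H.lt_top.le (by linarith)
          ht (Or.inr ht')).ne')
      have : 0 < k - r := by linarith
      have : 0 < 1 - t := by linarith
      positivity
    · obtain ⟨hz, h0⟩ := H.segment_EA_subset hz
      refine mem_frontier_of_affine_nonneg (isClosed_projRegion d k r R) hz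
        (c₀ := 1 / d) (c₁ := -(1 / d)) (c₂ := -(1 / d) + 1) (by positivity) (fun y hy => ?_) ?_
      · have := hy.1
        calc (0 : ℝ) ≤ _ := this
          _ = _ := by ring
      · rw [← h0]; ring

end RegionParams

/-! ### Extreme points. -/

/-- A zero of a nonnegative quadratic form is a minimum, so both partial derivatives in c and e
vanish there. -/
lemma projForm_critical {d k u c e p q : ℝ} (h : ∀ c e, 0 ≤ projForm d k u c e p q)
    (h₀ : projForm d k u c e p q = 0) :
    u * (((1 - p - q) / d - q) * c + p * (u * c + (k - u) * e)) = 0 ∧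
      (k - u) * ((1 - p - q) / d * e + p * (u * c + (k - u) * e)) = 0 := by
  have key : ∀ b m : ℝ, (∀ x : ℝ, 0 ≤ m * (x * x) + b * x + 0) → b = 0 := fun b m hb => by
    have := discrim_le_zero hb
    rw [discrim] at this
    nlinarith
  constructor
  · have := key (2 * (u * (((1 - p - q) / d - q) * c + p * (u * c + (k - u) * e))))
      (u * ((1 - p - q) / d - q) + p * u ^ 2) fun x => by
        have := h (c + x) e
        rw [projForm] at this h₀
        linarith
    linarith
  · have := key (2 * ((k - u) * ((1 - p - q) / d * e + p * (u * c + (k - u) * e))))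
      ((k - u) * ((1 - p - q) / d) + p * (k - u) ^ 2) fun x => by
        have := h c (e + x)
        rw [projForm] at this h₀
        linarith
    linarith

lemma projForm_eq_zero_of_mem_openSegment {d k u c e : ℝ} {x y z : ℝ × ℝ}
    (hz : z ∈ openSegment ℝ x y) (hx : 0 ≤ projForm d k u c e x.1 x.2)
    (hy : 0 ≤ projForm d k u c e y.1 y.2) (hz₀ : projForm d k u c e z.1 z.2 = 0) :
    projForm d k u c e x.1 x.2 = 0 := by
  rw [projForm_eq_affine] at *
  exact affine_eq_zero_of_mem_openSegment hz hx hy hz₀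

/-- For 0 < u < k both critical equations are available and together fix the point, so the
supporting line touches at one point only. For u = 0 or u = k one equation is void, which is why the
arc can be flat. -/
lemma eq_hypPoint_of_projForm_eq_zero {d k u t p q : ℝ} (hd : 4 ≤ d) (hk : 2 ≤ k) (hu : 0 < u)
    (huk : u < k) (ht : t ≤ 1) (ht' : -1 ≤ t) (h : ∀ c e, 0 ≤ projForm d k u c e p q)
    (h₀ : projForm d k u 1 (1 - t) p q = 0) : (p, q) = hypPoint d k u t := by
  obtain ⟨h₁, h₂⟩ := projForm_critical h h₀
  replace h₁ := (mul_eq_zero.1 h₁).resolve_left hu.ne'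
  replace h₂ := (mul_eq_zero.1 h₂).resolve_left (sub_pos.2 huk).ne'
  refine eq_hypPoint (by positivity) (hypDenom_pos hd hk hu.le huk.le ht ht' (Or.inl hu)).ne'
    (hypWeight_pos (by linarith) huk.le ht (Or.inl hu)).ne' ?_ ?_
  · linear_combination h₂ - h₁
  · rw [hypWeight]
    linear_combination h₂

lemma sub_eq_zero_of_mem_openSegment {d k r R : ℝ} {x y z : ℝ × ℝ} (hz : z ∈ openSegment ℝ x y)
    (hx : x ∈ projRegion d k r R) (hy : y ∈ projRegion d k r R)
    (hz₀ : (1 - z.1 - z.2) / d - z.2 = 0) : (1 - x.1 - x.2) / d - x.2 = 0 := by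
  have e : ∀ w : ℝ × ℝ, (1 - w.1 - w.2) / d - w.2 =
      1 / d + -(1 / d) * w.1 + (-(1 / d) - 1) * w.2 := fun w => by ring
  have hx' := hx.2.1
  have hy' := hy.2.1
  rw [e] at *
  exact affine_eq_zero_of_mem_openSegment hz hx' hy' hz₀

lemma add_eq_zero_of_mem_openSegment {d k r R : ℝ} {x y z : ℝ × ℝ} (hz : z ∈ openSegment ℝ x y)
    (hx : x ∈ projRegion d k r R) (hy : y ∈ projRegion d k r R)
    (hz₀ : (1 - z.1 - z.2) / d + z.2 = 0) : (1 - x.1 - x.2) / d + x.2 = 0 := by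
  have e : ∀ w : ℝ × ℝ, (1 - w.1 - w.2) / d + w.2 =
      1 / d + -(1 / d) * w.1 + (-(1 / d) + 1) * w.2 := fun w => by ring
  have hx' := hx.1
  have hy' := hy.1
  rw [e] at *
  exact affine_eq_zero_of_mem_openSegment hz hx' hy' hz₀

namespace RegionParams

variable {d k r R : ℝ} (H : RegionParams d k r R)

include H

lemma hypPoint_mem_extremePoints {u t : ℝ} (hu : 0 < u) (huk : u < k) (ht : t ≤ 1) (ht' : -1 ≤ t)
    (hmem : hypPoint d k u t ∈ projRegion d k r R)
    (h : ∀ y ∈ projRegion d k r R, ∀ c e, 0 ≤ projForm d k u c e y.1 y.2) :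
    hypPoint d k u t ∈ (projRegion d k r R).extremePoints ℝ := by
  have := H.four_le
  refine mem_extremePoints_iff_left.2 ⟨hmem, fun x hx y hy hxy => ?_⟩
  refine eq_hypPoint_of_projForm_eq_zero H.four_le H.two_le hu huk ht ht' (h x hx) ?_
  exact projForm_eq_zero_of_mem_openSegment hxy (h x hx _ _) (h y hy _ _)
    (projForm_hypPoint (by positivity)
      (hypDenom_pos H.four_le H.two_le hu.le huk.le ht ht' (Or.inl hu)).ne')

lemma vertexA_mem_extremePoints : (1, 0) ∈ (projRegion d k r R).extremePoints ℝ := by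
  have := H.four_le
  refine mem_extremePoints_iff_left.2 ⟨H.vertexA_mem, fun x hx y hy hxy => ?_⟩
  have h₁ := sub_eq_zero_of_mem_openSegment hxy hx hy (by simp)
  have h₂ := add_eq_zero_of_mem_openSegment hxy hx hy (by simp)
  have h3 : x.2 = 0 := by linarith
  rw [h3, add_zero, sub_zero, div_eq_zero_iff] at h₂
  have h4 := h₂.resolve_right (by linarith)
  ext
  · simp only; linarith
  · exact h3

/-- B is cut out by two supporting lines: a = q, and `projForm` with (c, e) = (1, 0), the case t =
1. -/
lemma vertexB_mem_extremePoints : hypPoint d k R 1 ∈ (projRegion d k r R).extremePoints ℝ := by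
  have := H.four_le; have := H.one_le
  have hB := hypPoint_one (k := k) H.four_le (u := R) (by linarith)
  have hs := (H.segment_AB_subset (right_mem_segment ℝ _ _)).2
  refine mem_extremePoints_iff_left.2 ⟨H.hypPoint_mem_of_nonneg zero_le_one le_rfl,
    fun x hx y hy hxy => ?_⟩
  have h₁ := sub_eq_zero_of_mem_openSegment hxy hx hy hs
  have h₂ := projForm_eq_zero_of_mem_openSegment (c := 1) (e := 0) hxy (hx.2.2.2 _ _)
    (hy.2.2.2 _ _) (by rw [projForm, hs, hB]; ring)
  rw [projForm, h₁] at h₂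
  have hp : x.1 = 0 := by
    have hR : R ^ 2 ≠ 0 := by positivity
    refine (mul_eq_zero.1 (?_ : x.1 * R ^ 2 = 0)).resolve_right hR
    linear_combination h₂
  rw [hp] at h₁
  have hq : x.2 = 1 / (d + 1) := by
    field_simp at h₁ ⊢
    linarith
  rw [hB]
  exact Prod.ext hp hq

lemma vertexE_mem_extremePoints :
    hypPoint d k r (-1) ∈ (projRegion d k r R).extremePoints ℝ := by
  have := H.four_le; have := H.two_le; have := H.lt_top
  have hD := H.vertexE_denom_pos
  have hs := (H.segment_EA_subset (left_mem_segment ℝ _ _)).2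
  have hd0 : d ≠ 0 := by linarith
  have hN := hypDenom_pos (t := -1) H.four_le H.two_le H.nonneg H.lt_top.le (by norm_num) le_rfl
    (Or.inr (by norm_num))
  have hw := hypWeight_pos (k := k) (u := r) (t := -1) (by linarith) H.lt_top.le (by norm_num)
    (Or.inr (by norm_num))
  have h0 := projForm_hypPoint (k := k) (u := r) hd0 hN.ne'
  refine mem_extremePoints_iff_left.2 ⟨H.hypPoint_mem_of_nonpos le_rfl (by norm_num),
    fun x hx y hy hxy => ?_⟩
  have h₁ := add_eq_zero_of_mem_openSegment hxy hx hy hs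
  have h₂ := projForm_eq_zero_of_mem_openSegment hxy (hx.2.2.1 _ _) (hy.2.2.1 _ _) h0
  refine eq_hypPoint hd0 hN.ne' hw.ne' (by linarith) ?_
  rw [projForm] at h₂
  rw [hypWeight] at hw ⊢
  have hw' : 2 * k - r ≠ 0 := by linarith
  refine mul_left_cancel₀ hw' ?_
  linear_combination h₂ + r * h₁

/-- For r < R the supporting lines of the two conics at t = 0 differ, and subtracting their
equations gives (R - r)q = 0. For r = R there is a single conic with 0 < r < k, and C is an ordinary
point of its curved arc. -/
lemma vertexC_mem_extremePoints :
    (-1 / (k * d - 1), 0) ∈ (projRegion d k r R).extremePoints ℝ := by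
  have := H.four_le; have := H.two_le; have := H.lt_top; have := H.one_le
  have hd0 : d ≠ 0 := by linarith
  rcases H.le.lt_or_eq with hrR | hrR
  · have hN : ∀ u, 0 ≤ u → u ≤ k → hypDenom d k u 0 ≠ 0 := fun u hu huk =>
      (hypDenom_pos H.four_le H.two_le hu huk zero_le_one (by norm_num) (Or.inr le_rfl)).ne'
    have hw := hypWeight_pos (k := k) (u := r) (t := 0) (by linarith) H.lt_top.le zero_le_one
      (Or.inr le_rfl)
    have hr₀ := projForm_hypPoint hd0 (hN r H.nonneg H.lt_top.le)
    have hR₀ := projForm_hypPoint hd0 (hN R (by linarith) H.le_top)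
    have hC : (-1 / (k * d - 1), 0) ∈ projRegion d k r R := by
      rw [← hypPoint_zero (u := r)]
      exact H.hypPoint_mem_of_nonpos (by norm_num) le_rfl
    rw [hypPoint_zero] at hr₀ hR₀
    refine mem_extremePoints_iff_left.2 ⟨hC, fun x hx y hy hxy => ?_⟩
    have h₁ := projForm_eq_zero_of_mem_openSegment hxy (hx.2.2.1 _ _) (hy.2.2.1 _ _) hr₀
    have h₂ := projForm_eq_zero_of_mem_openSegment hxy (hx.2.2.2 _ _) (hy.2.2.2 _ _) hR₀
    rw [projForm] at h₁ h₂
    have hq : x.2 = 0 := by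
      refine (mul_eq_zero.1 (?_ : (R - r) * x.2 = 0)).resolve_left (sub_pos.2 hrR).ne'
      linear_combination h₁ - h₂
    rw [← hypPoint_zero (u := r)]
    refine eq_hypPoint hd0 (hN r H.nonneg H.lt_top.le) hw.ne' (by simpa using hq) ?_
    rw [hypWeight]
    have hk : k ≠ 0 := by linarith
    refine mul_left_cancel₀ hk ?_
    linear_combination h₁ + r * hq
  · have hr : 0 < r := by linarith
    rw [← hypPoint_zero (u := r)]
    exact H.hypPoint_mem_extremePoints hr H.lt_top zero_le_one (by norm_num)
      (H.hypPoint_mem_of_nonpos (by norm_num) le_rfl) fun y hy => hy.2.2.1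

lemma upperArc_subset_extremePoints (hR : R < k) :
    hypPoint d k R '' Set.Icc 0 1 ⊆ (projRegion d k r R).extremePoints ℝ := by
  rintro _ ⟨t, ⟨ht, ht'⟩, rfl⟩
  have := H.one_le
  exact H.hypPoint_mem_extremePoints (by linarith) hR ht' (by linarith)
    (H.hypPoint_mem_of_nonneg ht ht') fun y hy => hy.2.2.2

lemma lowerArc_subset_extremePoints (hr : 0 < r) :
    hypPoint d k r '' Set.Icc (-1) 0 ⊆ (projRegion d k r R).extremePoints ℝ := by
  rintro _ ⟨t, ⟨ht, ht'⟩, rfl⟩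
  exact H.hypPoint_mem_extremePoints hr H.lt_top (by linarith) ht
    (H.hypPoint_mem_of_nonpos ht ht') fun y hy => hy.2.2.1

/-- For u = k the conic is the line pair a(a - q + kp) = 0. The convex weights are the two summands
of the denominator in `hN'`. -/
lemma upperArc_eq_segment (hR : R = k) :
    hypPoint d k R '' Set.Icc 0 1 = segment ℝ (hypPoint d k R 1) (-1 / (k * d - 1), 0) := by
  have := H.four_le; have := H.two_le
  have hkd : 0 < k * d - 1 := by nlinarith
  subst hR
  rw [hypPoint_one H.four_le (by linarith)]
  apply Set.Subset.antisymm
  · rintro _ ⟨t, ⟨ht, ht'⟩, rfl⟩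
    have hN := hypDenom_pos (k := R) (u := R) (t := t) H.four_le H.two_le (by linarith) le_rfl ht'
      (by linarith) (Or.inl (by linarith))
    have hN' : hypDenom d R R t = t * (R * (d + 1)) + (1 - t) * (R * d - 1) := by
      rw [hypDenom, hypWeight]; ring
    have h1t := sub_nonneg.2 ht'
    refine ⟨t * (R * (d + 1)) / hypDenom d R R t, (1 - t) * (R * d - 1) / hypDenom d R R t,
      by positivity, by positivity, ?_, ?_⟩
    · rw [← add_div, ← hN', div_self hN.ne']
    · simp only [Prod.smul_mk, smul_eq_mul, mul_zero, Prod.mk_add_mk, add_zero, zero_add,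
        hypPoint, hypWeight]
      ext <;> simp only
      · field_simp
      · field_simp
        ring
  · rintro _ ⟨α, β, hα, hβ, hαβ, rfl⟩
    simp only [Prod.smul_mk, smul_eq_mul, mul_zero, Prod.mk_add_mk, add_zero, zero_add]
    set q := α * (1 / (d + 1)) with hq
    set p := β * (-1 / (R * d - 1)) with hp
    have h1 : β = -p * (R * d - 1) := by rw [hp]; field_simp
    have h2 : α = q * (d + 1) := by rw [hq]; field_simp
    have ha : (1 - p - q) / d = q - R * p := by
      rw [div_eq_iff (by linarith), ← hαβ, h1, h2]
      ring
    have hq0 : 0 ≤ q := by positivity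
    have hp0 : 0 ≤ -p := by nlinarith
    have ha0 : 0 < q - R * p := by
      rcases hq0.eq_or_lt with h | h
      · rcases hp0.eq_or_lt with h' | h'
        · rw [h1, h2, ← h, ← h'] at hαβ; norm_num at hαβ
        · nlinarith
      · nlinarith
    have hRp : 0 ≤ R * -p := by positivity
    rw [eq_hypPoint_of_conic_eq_zero (k := R) (u := R) H.four_le H.two_le (by linarith) le_rfl
      (by rw [ha]; linarith) (by rw [ha]; linarith) (by rw [ha]; exact ha0) (Or.inl (by linarith))
      (by rw [conic, ha]; ring), ha]
    refine ⟨_, ⟨by positivity, ?_⟩, rfl⟩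
    rw [div_le_one ha0]
    linarith

/-- For u = 0 the conic is the line pair (a - q)(a + kp) = 0, and the arc lies on the second line.
-/
lemma lowerArc_eq_segment (hr : r = 0) :
    hypPoint d k r '' Set.Icc (-1) 0 = segment ℝ (-1 / (k * d - 1), 0) (hypPoint d k r (-1)) := by
  have := H.four_le; have := H.two_le
  have hkd : 0 < k * d - 1 := by nlinarith
  subst hr
  have hD := H.vertexE_denom_pos
  have hD' : 0 < k * d - k - 1 := by linarith
  have hE : hypPoint d k 0 (-1) = (-1 / (k * d - k - 1), -k / (k * d - k - 1)) := by
    rw [hypPoint_neg_one]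
    have : d * (2 * k - 0) - (2 * k - 0) - 2 = 2 * (k * d - k - 1) := by ring
    rw [this]
    ext <;> simp only
    · field_simp
    · field_simp
      ring
  rw [hE]
  apply Set.Subset.antisymm
  · rintro _ ⟨t, ⟨ht, ht'⟩, rfl⟩
    have hN := hypDenom_pos (k := k) (u := 0) (t := t) H.four_le H.two_le le_rfl (by linarith)
      (by linarith) ht (Or.inr ht')
    have hN' : hypDenom d k 0 t = (1 - t) * ((d + t) * k - 1) := by
      rw [hypDenom, hypWeight]; ring
    have h1t : 0 < 1 - t := by linarith
    have hM : 0 < (d + t) * k - 1 := by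
      rw [hN'] at hN
      exact pos_of_mul_pos_right hN h1t.le
    have h2t : 0 ≤ 1 + t := by linarith
    have h3t : 0 ≤ -t := by linarith
    -- The weight of the second end point is read off from the second coordinate, as C has second
    -- coordinate zero.
    refine ⟨(1 + t) * (k * d - 1) / ((d + t) * k - 1), -t * (k * d - k - 1) / ((d + t) * k - 1),
      by positivity, by positivity, ?_, ?_⟩
    · rw [← add_div, div_eq_one_iff_eq hM.ne']
      ring
    · simp only [Prod.smul_mk, smul_eq_mul, mul_zero, Prod.mk_add_mk, zero_add,
        hypPoint, hN']
      rw [show hypWeight k 0 t = (1 - t) * k by rw [hypWeight]; ring]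
      clear hN hN' hE hD
      generalize k * d - k - 1 = F at hD' ⊢
      generalize k * d - 1 = G at hkd ⊢
      generalize (d + t) * k - 1 = M at hM ⊢
      ext <;> simp only <;> field_simp
      ring
  · rintro _ ⟨α, β, hα, hβ, hαβ, rfl⟩
    simp only [Prod.smul_mk, smul_eq_mul, mul_zero, Prod.mk_add_mk, zero_add]
    set p := α * (-1 / (k * d - 1)) + β * (-1 / (k * d - k - 1)) with hp
    set q := β * (-k / (k * d - k - 1)) with hq
    have hβq : β * k = -q * (k * d - k - 1) := by
      rw [hq]
      linear_combination β * div_mul_cancel₀ (-k) hD'.ne'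
    have hpq : p * (k * d - 1) = q - 1 := by
      rw [hp, hq]
      linear_combination α * div_mul_cancel₀ (-1) hkd.ne' + β * div_mul_cancel₀ (-1) hD'.ne' - hαβ
    have ha : (1 - p - q) / d = -(k * p) := by
      rw [div_eq_iff (by linarith)]
      linarith
    have hq0 : 0 ≤ -q := by
      refine nonneg_of_mul_nonneg_left (?_ : 0 ≤ -q * (k * d - k - 1)) hD'
      rw [← hβq]
      positivity
    have hp0 : 0 < -p := by
      refine pos_of_mul_pos_left (?_ : 0 < -p * (k * d - 1)) hkd.le
      linarith
    have ha0 : 0 < -(k * p) := by nlinarith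
    have haq : 0 ≤ -(k * p) + q := by
      refine nonneg_of_mul_nonneg_left (?_ : 0 ≤ _ * (k * d - 1)) hkd
      have : (-(k * p) + q) * (k * d - 1) = k * α := by
        linear_combination -k * hpq + hβq - k * hαβ
      rw [this]
      positivity
    rw [eq_hypPoint_of_conic_eq_zero (k := k) (u := 0) H.four_le H.two_le le_rfl (by linarith)
      (by rw [ha]; linarith) (by rw [ha]; linarith) (by rw [ha]; exact ha0) (Or.inr (by linarith))
      (by rw [conic, ha]; ring), ha]
    refine ⟨_, ⟨?_, div_nonpos_of_nonpos_of_nonneg (by linarith) ha0.le⟩, rfl⟩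
    rw [le_div_iff₀ ha0]
    linarith

/-- Extreme points lie on the boundary, and a segment contains no extreme points besides its ends.
-/
lemma extremePoints_cases {z : ℝ × ℝ} (hz : z ∈ (projRegion d k r R).extremePoints ℝ) :
    z ∈ ({(1, 0), hypPoint d k R 1, (-1 / (k * d - 1), 0), hypPoint d k r (-1)} : Set (ℝ × ℝ)) ∨
      (R < k ∧ z ∈ hypPoint d k R '' Set.Icc 0 1) ∨
      (0 < r ∧ z ∈ hypPoint d k r '' Set.Icc (-1) 0) := by
  have hseg : ∀ x y : ℝ × ℝ, x ∈ (projRegion d k r R).extremePoints ℝ →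
      y ∈ (projRegion d k r R).extremePoints ℝ → z ∈ segment ℝ x y → z = x ∨ z = y :=
    fun x y hx hy h => by
      have := (mem_extremePoints_iff_forall_segment.1 hz).2 x hx.1 y hy.1 h
      exact this.imp Eq.symm Eq.symm
  have hfr : z ∈ frontier (projRegion d k r R) := by
    rw [(isClosed_projRegion d k r R).frontier_eq]
    exact ⟨hz.1, fun h => (disjoint_interior_extremePoints _).le_bot ⟨h, hz⟩⟩
  rw [H.frontier_eq] at hfr
  rcases hfr with ((h | h) | h) | h
  · rcases hseg _ _ H.vertexA_mem_extremePoints H.vertexB_mem_extremePoints h with h | h <;>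
      simp [h]
  · rcases H.le_top.lt_or_eq with hR | hR
    · exact Or.inr (Or.inl ⟨hR, h⟩)
    · rw [H.upperArc_eq_segment hR] at h
      rcases hseg _ _ H.vertexB_mem_extremePoints H.vertexC_mem_extremePoints h with h | h <;>
        simp [h]
  · rcases H.nonneg.lt_or_eq with hr | hr
    · exact Or.inr (Or.inr ⟨hr, h⟩)
    · rw [H.lowerArc_eq_segment hr.symm] at h
      rcases hseg _ _ H.vertexC_mem_extremePoints H.vertexE_mem_extremePoints h with h | h <;>
        simp [h]
  · rcases hseg _ _ H.vertexE_mem_extremePoints H.vertexA_mem_extremePoints h with h | h <;>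
      simp [h]

lemma vertices_subset_extremePoints :
    ({(1, 0), hypPoint d k R 1, (-1 / (k * d - 1), 0), hypPoint d k r (-1)} : Set (ℝ × ℝ)) ⊆
      (projRegion d k r R).extremePoints ℝ := by
  rintro z (rfl | rfl | rfl | rfl)
  exacts [H.vertexA_mem_extremePoints, H.vertexB_mem_extremePoints, H.vertexC_mem_extremePoints,
    H.vertexE_mem_extremePoints]

end RegionParams

/-! ### The curves as hyperbolas. -/

/-- The coefficients of x² and y² have opposite signs, and the determinant is d⁴u(k - u)/4. -/
lemma isHyperbola_fCurve {d k : ℕ} (hd : 0 < d) (hkd : 1 < k * d) {u : ℝ} (hu : 0 < u)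
    (huk : u < k) : IsHyperbola (fCurve d k u) := by
  have hd' : (0 : ℝ) < d := by exact_mod_cast hd
  have hkd' : (1 : ℝ) < k * d := by exact_mod_cast hkd
  refine ⟨1 - k * d, 1 + (1 + d) * (1 - k * d) + d ^ 2 * u, 1 + d, k * d - 2, -(d + 2), 1,
    ?_, ?_, ?_⟩
  · ext z
    change fQuad _ _ _ _ _ = 0 ↔ _ = 0
    rw [fQuad]
    ring_nf
  · have : 0 < (k * d - 1 : ℝ) * (1 + d) := mul_pos (by linarith) (by linarith)
    nlinarith [sq_nonneg (1 + (1 + d) * (1 - k * d) + d ^ 2 * u : ℝ)]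
  · have : (d : ℝ) ^ 4 * (u * (k - u)) / 4 ≠ 0 := by
      have := sub_pos.2 huk
      positivity
    rw [det_fin_three]
    simp only [of_apply, cons_val]
    convert this using 1
    ring

/-- On the line y = 2 the equation in x has leading coefficient 1 - kd < 0 and constant term 1 + 2d
> 0, hence a nonzero real root. There the two polynomials differ by 2d²(u - v)x. -/
lemma fCurve_injective {d k : ℕ} (hd : 0 < d) (hkd : 1 < k * d) {u v : ℝ}
    (h : fCurve d k u = fCurve d k v) : u = v := by
  have hd' : (0 : ℝ) < d := by exact_mod_cast hd
  have hkd' : (1 : ℝ) < k * d := by exact_mod_cast hkd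
  set b : ℝ := 2 * (1 + (1 + d) * (1 - k * d) + d ^ 2 * u) + (k * d - 2) with hb
  have hdis : 0 ≤ discrim (1 - k * d : ℝ) b (1 + 2 * d) := by
    have : 0 < (k * d - 1 : ℝ) * (1 + 2 * d) := mul_pos (by linarith) (by linarith)
    rw [discrim]
    nlinarith [sq_nonneg b]
  obtain ⟨x, hx⟩ := exists_quadratic_eq_zero (a := (1 - k * d : ℝ)) (b := b) (c := 1 + 2 * d)
    (by linarith) ⟨√(discrim (1 - k * d : ℝ) b (1 + 2 * d)), (Real.mul_self_sqrt hdis).symm⟩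
  have hx0 : x ≠ 0 := by
    rintro rfl
    simp only [mul_zero, zero_add] at hx
    linarith
  have hmem : (x, (2 : ℝ)) ∈ fCurve d k u := by
    change fQuad _ _ _ _ _ = 0
    rw [fQuad]
    linear_combination hx
  have hmem' : fQuad d k v x 2 = 0 := by
    rw [h] at hmem
    exact hmem
  have hmem : fQuad d k u x 2 = 0 := hmem
  rw [fQuad] at hmem hmem'
  have : (u - v) * (2 * (d : ℝ) ^ 2 * x) = 0 := by linear_combination hmem - hmem'
  have := (mul_eq_zero.1 this).resolve_right (by positivity)
  linarith

/-! ### Explicit inequalities in the four cases. -/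

lemma affine_nonneg_iff {d : ℝ} (hd : 0 < d) (p q x : ℝ) :
    0 ≤ (1 - p - q) / d + x ↔ p + q - d * x ≤ 1 := by
  rw [div_add' _ _ _ hd.ne', le_div_iff₀ hd]
  constructor <;> intro h <;> linarith

namespace RegionParams

/-- With a = (1 - p - q)/d the inequalities read a - q ≥ 0, a - q + kp ≥ 0, a + kp ≥ 0 and a + q ≥
0. The middle two are the nontrivial factors of the degenerate conics for u = k and u = 0. -/
lemma mem_iff_of_zero_of_top {d k : ℝ} (H : RegionParams d k 0 k) (p q : ℝ) :
    (p, q) ∈ projRegion d k 0 k ↔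
      p + (1 + d) * q ≤ 1 ∧ (1 - k * d) * p + (1 + d) * q ≤ 1 ∧
        (1 - k * d) * p + q ≤ 1 ∧ p + (1 - d) * q ≤ 1 := by
  have hd : 0 < d := by linarith [H.four_le]
  have hk : 0 < k := by linarith [H.two_le]
  rw [H.mem_iff, show p + (1 + d) * q = p + q - d * -q by ring,
    show (1 - k * d) * p + (1 + d) * q = p + q - d * (k * p - q) by ring,
    show (1 - k * d) * p + q = p + q - d * (k * p) by ring,
    show p + (1 - d) * q = p + q - d * q by ring, ← affine_nonneg_iff hd, ← affine_nonneg_iff hd,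
    ← affine_nonneg_iff hd, ← affine_nonneg_iff hd, conic, conic]
  generalize (1 - p - q) / d = a
  constructor
  · rintro ⟨h₁, h₂, hp | ⟨hb, hr, hR⟩⟩
    · have : 0 ≤ k * p := by positivity
      exact ⟨by linarith, by linarith, by linarith, h₁⟩
    · have ha : 0 < a := by linarith
      refine ⟨by linarith, nonneg_of_mul_nonneg_right (?_ : 0 ≤ a * _) ha,
        nonneg_of_mul_nonneg_right (?_ : 0 ≤ (a - q) * _) hb, h₁⟩ <;> linarith
  · rintro ⟨h₁, h₂, h₃, h₄⟩
    refine ⟨h₄, by linarith, (le_or_gt 0 p).imp_right fun hp => ?_⟩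
    have hkp : k * p < 0 := mul_neg_of_pos_of_neg hk hp
    have e1 := mul_nonneg (by linarith : 0 ≤ a - q) h₃
    have e2 := mul_nonneg (by linarith : 0 ≤ a) h₂
    refine ⟨by linarith, ?_, ?_⟩ <;> linarith

lemma mem_iff_of_zero {d k : ℕ} {R : ℝ} (H : RegionParams d k 0 R) (p q : ℝ) :
    (p, q) ∈ projRegion d k 0 R ↔
      p + (1 + (d : ℝ)) * q ≤ 1 ∧ 0 ≤ fQuad d k R p q ∧
        (1 - (k : ℝ) * d) * p + q ≤ 1 ∧ p + (1 - (d : ℝ)) * q ≤ 1 := by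
  have hd : (0 : ℝ) < d := by linarith [H.four_le]
  have hk : (0 : ℝ) < k := by linarith [H.two_le]
  have hR : 0 < R := by linarith [H.one_le]
  have hRk := sub_nonneg.2 H.le_top
  rw [H.mem_iff, fQuad_eq_conic (by exact_mod_cast hd), mul_nonneg_iff_of_pos_left (by positivity),
    show p + (1 + (d : ℝ)) * q = p + q - d * -q by ring,
    show (1 - (k : ℝ) * d) * p + q = p + q - d * (k * p) by ring,
    show p + (1 - (d : ℝ)) * q = p + q - d * q by ring, ← affine_nonneg_iff hd,
    ← affine_nonneg_iff hd, ← affine_nonneg_iff hd, conic, conic]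
  generalize (1 - p - q) / (d : ℝ) = a
  constructor
  · rintro ⟨h₁, h₂, hp | ⟨hb, hr, hR⟩⟩
    · have ha : 0 ≤ a := by linarith
      have e1 : 0 ≤ k * p := by positivity
      have e2 : 0 ≤ a * (a - q) + p * (R * a + (k - R) * (a - q)) := by positivity
      exact ⟨by linarith, by linarith, by linarith, h₁⟩
    · exact ⟨by linarith, hR, nonneg_of_mul_nonneg_right (by linarith : 0 ≤ (a - q) * _) hb, h₁⟩
  · rintro ⟨h₁, h₂, h₃, h₄⟩
    refine ⟨h₄, by linarith, (le_or_gt 0 p).imp_right fun hp => ?_⟩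
    have hkp : k * p < 0 := mul_neg_of_pos_of_neg hk hp
    -- If a = q, the conic value reduces to pRa, which is negative.
    have hb : 0 < a - q := by
      refine lt_of_le_of_ne (by linarith) fun h => ?_
      have hq : q = a := by linarith
      have : p * (R * a) < 0 := mul_neg_of_neg_of_pos hp (mul_pos hR (by linarith))
      rw [hq] at h₂
      linarith
    have e1 := mul_nonneg hb.le h₃
    exact ⟨hb, by linarith, h₂⟩

lemma mem_iff_of_top {d k : ℕ} {r : ℝ} (H : RegionParams d k r k) (p q : ℝ) :
    (p, q) ∈ projRegion d k r k ↔
      p + (1 + (d : ℝ)) * q ≤ 1 ∧ (1 - (k : ℝ) * d) * p + (1 + (d : ℝ)) * q ≤ 1 ∧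
        0 ≤ fQuad d k r p q ∧ p + (1 - (d : ℝ)) * q ≤ 1 := by
  have hd : (0 : ℝ) < d := by linarith [H.four_le]
  have hk : (0 : ℝ) < k := by linarith [H.two_le]
  have hr := H.nonneg
  have hrk := sub_nonneg.2 H.lt_top.le
  rw [H.mem_iff, fQuad_eq_conic (by exact_mod_cast hd), mul_nonneg_iff_of_pos_left (by positivity),
    show p + (1 + (d : ℝ)) * q = p + q - d * -q by ring,
    show (1 - (k : ℝ) * d) * p + (1 + d) * q = p + q - d * (k * p - q) by ring,
    show p + (1 - (d : ℝ)) * q = p + q - d * q by ring, ← affine_nonneg_iff hd,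
    ← affine_nonneg_iff hd, ← affine_nonneg_iff hd, conic, conic]
  generalize (1 - p - q) / (d : ℝ) = a
  constructor
  · rintro ⟨h₁, h₂, hp | ⟨hb, hr, hR⟩⟩
    · have ha : 0 ≤ a := by linarith
      have e1 : 0 ≤ k * p := by positivity
      have e2 : 0 ≤ a * (a - q) + p * (r * a + (k - r) * (a - q)) := by positivity
      exact ⟨by linarith, by linarith, by linarith, h₁⟩
    · have ha : 0 < a := by linarith
      exact ⟨by linarith, nonneg_of_mul_nonneg_right (by linarith : 0 ≤ a * _) ha, hr, h₁⟩
  · rintro ⟨h₁, h₂, h₃, h₄⟩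
    refine ⟨h₄, by linarith, (le_or_gt 0 p).imp_right fun hp => ?_⟩
    have hkp : k * p < 0 := mul_neg_of_pos_of_neg hk hp
    have e1 := mul_nonneg (by linarith : 0 ≤ a) h₂
    exact ⟨by linarith, h₃, by linarith⟩

lemma mem_iff_of_pos {d k : ℕ} {r R : ℝ} (H : RegionParams d k r R) (p q : ℝ) :
    (p, q) ∈ projRegion d k r R ↔
      p + (1 + (d : ℝ)) * q ≤ 1 ∧ 0 ≤ fQuad d k R p q ∧ 0 ≤ fQuad d k r p q ∧
        p + (1 - (d : ℝ)) * q ≤ 1 := by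
  have hd : (0 : ℝ) < d := by linarith [H.four_le]
  have hR : 0 < R := by linarith [H.one_le]
  have hRk := sub_nonneg.2 H.le_top
  have hr := H.nonneg
  have hrk := sub_nonneg.2 H.lt_top.le
  have hsum : d * ((1 - p - q) / d) + p + q = 1 := by field_simp; ring
  rw [H.mem_iff, fQuad_eq_conic (by exact_mod_cast hd), fQuad_eq_conic (by exact_mod_cast hd),
    mul_nonneg_iff_of_pos_left (by positivity), mul_nonneg_iff_of_pos_left (by positivity),
    show p + (1 + (d : ℝ)) * q = p + q - d * -q by ring,
    show p + (1 - (d : ℝ)) * q = p + q - d * q by ring, ← affine_nonneg_iff hd,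
    ← affine_nonneg_iff hd, conic, conic]
  generalize (1 - p - q) / (d : ℝ) = a at hsum ⊢
  constructor
  · rintro ⟨h₁, h₂, hp | ⟨hb, hr, hR⟩⟩
    · have ha : 0 ≤ a := by linarith
      have e1 : 0 ≤ a * (a - q) + p * (R * a + (k - R) * (a - q)) := by positivity
      have e2 : 0 ≤ a * (a - q) + p * (r * a + (k - r) * (a - q)) := by positivity
      exact ⟨by linarith, by linarith, by linarith, h₁⟩
    · exact ⟨by linarith, hR, hr, h₁⟩
  · rintro ⟨h₁, h₂, h₃, h₄⟩
    refine ⟨h₄, by linarith, (le_or_gt 0 p).imp_right fun hp => ?_⟩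
    refine ⟨lt_of_le_of_ne (by linarith) fun h => ?_, h₃, h₂⟩
    have hq : q = a := by linarith
    rw [hq] at h₂ hsum
    -- Here a = q = 0 would force p = 1 through da + p + q = 1, contradicting p < 0.
    have ha : 0 < a := by
      by_contra! hle
      have : a = 0 := by linarith
      rw [this] at hsum
      linarith
    have : p * (R * a) < 0 := mul_neg_of_neg_of_pos hp (mul_pos hR ha)
    linarith

end RegionParams

/-! ### Identification of the vertices and conclusion. -/

lemma vtxB_eq_hypPoint {d : ℕ} (k : ℝ) (hd : 4 ≤ d) {u : ℝ} (hu : 0 < u) :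
    vtxB d = hypPoint d k u 1 := (hypPoint_one (by exact_mod_cast hd) hu).symm

lemma vtxC_eq_hypPoint (d k : ℕ) (u : ℝ) : vtxC d k = hypPoint d k u 0 := hypPoint_zero.symm

lemma vtxD_eq_hypPoint (d k : ℕ) : vtxD d k = hypPoint d k 0 (-1) := by
  rw [hypPoint_neg_one, vtxD,
    show (d : ℝ) * (2 * k - 0) - (2 * k - 0) - 2 = 2 * (k * d - k - 1) by ring]
  ext <;> simp only
  · rw [show (-2 : ℝ) = 2 * -1 by norm_num, mul_div_mul_left _ _ two_ne_zero]
  · rw [show -(2 * (k : ℝ) - 0) = 2 * -k by ring, mul_div_mul_left _ _ two_ne_zero]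

lemma vtxE_eq_hypPoint (d : ℕ) (k : ℝ) : vtxE d = hypPoint d k (2 * k - d) (-1) := by
  rw [hypPoint_neg_one, vtxE, show 2 * k - (2 * k - d) = (d : ℝ) by ring, sq]

theorem mainTheorem1 (d k : ℕ) (hd : 4 ≤ d) (hd_even : Even d) (hk1 : 1 < k) (hkd : k < d) :
    -- case (1): `k ≤ d / 2`, `k` even
    (2 * k ≤ d → Even k →
      (∀ p q : ℝ, (p, q) ∈ kPosRegion d k ↔
        p + (1 + (d : ℝ)) * q ≤ 1 ∧ (1 - (k : ℝ) * d) * p + (1 + (d : ℝ)) * q ≤ 1 ∧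
        (1 - (k : ℝ) * d) * p + q ≤ 1 ∧ p + (1 - (d : ℝ)) * q ≤ 1) ∧
      (kPosRegion d k).extremePoints ℝ = {vtxA, vtxB d, vtxC d k, vtxD d k} ∧
      frontier (kPosRegion d k) =
        segment ℝ vtxA (vtxB d) ∪ segment ℝ (vtxB d) (vtxC d k) ∪
        segment ℝ (vtxC d k) (vtxD d k) ∪ segment ℝ (vtxD d k) vtxA) ∧
    -- case (2): `k ≤ d / 2`, `k` odd
    (2 * k ≤ d → Odd k →
      (∀ p q : ℝ, (p, q) ∈ kPosRegion d k ↔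
        p + (1 + (d : ℝ)) * q ≤ 1 ∧ 0 ≤ fQuad d k ((k : ℝ) - 1) p q ∧
        (1 - (k : ℝ) * d) * p + q ≤ 1 ∧ p + (1 - (d : ℝ)) * q ≤ 1) ∧
      IsHyperbola (fCurve d k ((k : ℝ) - 1)) ∧
      ∃ C₁ : Set (ℝ × ℝ), IsArcOf (fCurve d k ((k : ℝ) - 1)) (vtxB d) (vtxC d k) C₁ ∧
        (kPosRegion d k).extremePoints ℝ = {vtxA, vtxB d, vtxC d k, vtxD d k} ∪ C₁ ∧
        frontier (kPosRegion d k) =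
          segment ℝ vtxA (vtxB d) ∪ C₁ ∪
          segment ℝ (vtxC d k) (vtxD d k) ∪ segment ℝ (vtxD d k) vtxA) ∧
    -- case (3): `d / 2 < k`, `k` even
    (d < 2 * k → Even k →
      (∀ p q : ℝ, (p, q) ∈ kPosRegion d k ↔
        p + (1 + (d : ℝ)) * q ≤ 1 ∧ (1 - (k : ℝ) * d) * p + (1 + (d : ℝ)) * q ≤ 1 ∧
        0 ≤ fQuad d k (2 * (k : ℝ) - d) p q ∧ p + (1 - (d : ℝ)) * q ≤ 1) ∧
      IsHyperbola (fCurve d k (2 * (k : ℝ) - d)) ∧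
      ∃ C₂ : Set (ℝ × ℝ), IsArcOf (fCurve d k (2 * (k : ℝ) - d)) (vtxC d k) (vtxE d) C₂ ∧
        (kPosRegion d k).extremePoints ℝ = {vtxA, vtxB d, vtxC d k, vtxE d} ∪ C₂ ∧
        frontier (kPosRegion d k) =
          segment ℝ vtxA (vtxB d) ∪ segment ℝ (vtxB d) (vtxC d k) ∪
          C₂ ∪ segment ℝ (vtxE d) vtxA) ∧
    -- case (4): `d / 2 < k`, `k` odd
    (d < 2 * k → Odd k →
      (∀ p q : ℝ, (p, q) ∈ kPosRegion d k ↔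
        p + (1 + (d : ℝ)) * q ≤ 1 ∧ 0 ≤ fQuad d k ((k : ℝ) - 1) p q ∧
        0 ≤ fQuad d k (2 * (k : ℝ) - d) p q ∧ p + (1 - (d : ℝ)) * q ≤ 1) ∧
      IsHyperbola (fCurve d k ((k : ℝ) - 1)) ∧
      IsHyperbola (fCurve d k (2 * (k : ℝ) - d)) ∧
      ∃ C₁ C₂ : Set (ℝ × ℝ),
        IsArcOf (fCurve d k ((k : ℝ) - 1)) (vtxB d) (vtxC d k) C₁ ∧
        IsArcOf (fCurve d k (2 * (k : ℝ) - d)) (vtxC d k) (vtxE d) C₂ ∧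
        (kPosRegion d k).extremePoints ℝ = {vtxA, vtxB d, vtxC d k, vtxE d} ∪ C₁ ∪ C₂ ∧
        frontier (kPosRegion d k) =
          segment ℝ vtxA (vtxB d) ∪ C₁ ∪ C₂ ∪ segment ℝ (vtxE d) vtxA) ∧
    -- the two hyperbolas coincide precisely when `k = d - 1`
    (d < 2 * k → (fCurve d k ((k : ℝ) - 1) = fCurve d k (2 * (k : ℝ) - d) ↔ k + 1 = d)) := by
  have hd' : (4 : ℝ) ≤ d := by exact_mod_cast hd
  have hk' : (2 : ℝ) ≤ k := by exact_mod_cast hk1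
  have hkd' : (k : ℝ) + 1 ≤ d := by exact_mod_cast hkd
  have hmul : 1 < k * d := by nlinarith
  have hr_small : 2 * k ≤ d → ((2 * k - d : ℕ) : ℝ) = 0 := fun h => by
    rw [Nat.sub_eq_zero_of_le h, Nat.cast_zero]
  have hr_large : d < 2 * k → ((2 * k - d : ℕ) : ℝ) = 2 * (k : ℝ) - d := fun h => by
    rw [Nat.cast_sub h.le, Nat.cast_mul, Nat.cast_ofNat]
  have hR_even : Even k → ((if Even k then k else k - 1 : ℕ) : ℝ) = k := fun h => by rw [if_pos h]
  have hR_odd : Odd k → ((if Even k then k else k - 1 : ℕ) : ℝ) = (k : ℝ) - 1 := fun h => by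
    rw [if_neg (Nat.not_even_iff_odd.2 h), Nat.cast_sub hk1.le, Nat.cast_one]
  have hset := kPosRegion_eq_projRegion hd hd_even hk1 hkd rfl rfl
  have arc₁ : IsArcOf (fCurve d k ((k : ℝ) - 1)) (vtxB d) (vtxC d k)
      (hypPoint d k ((k : ℝ) - 1) '' Set.Icc 0 1) := by
    have := isArcOf_hypPoint hd hk1 (u := (k : ℝ) - 1) (x := 1) (by linarith) (by linarith) le_rfl
      zero_le_one (Or.inl (by linarith))
    rwa [sub_self, ← vtxC_eq_hypPoint, ← vtxB_eq_hypPoint _ hd (by linarith)] at this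
  have arc₂ : IsArcOf (fCurve d k (2 * (k : ℝ) - d)) (vtxC d k) (vtxE d)
      (hypPoint d k (2 * (k : ℝ) - d) '' Set.Icc (-1) 0) ∨ 2 * k ≤ d := by
    refine (lt_or_ge d (2 * k)).imp_left fun h => ?_
    have h' : (d : ℝ) < 2 * k := by exact_mod_cast h
    have := isArcOf_hypPoint hd hk1 (u := 2 * (k : ℝ) - d) (x := 0) (by linarith) (by linarith)
      zero_le_one le_rfl (Or.inr rfl)
    rwa [zero_sub, ← vtxC_eq_hypPoint, ← vtxE_eq_hypPoint] at this
  have hA : vtxA = (1, 0) := rfl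
  have hC : vtxC d k = (-1 / ((k : ℝ) * d - 1), 0) := rfl
  refine ⟨fun h he => ?_, fun h ho => ?_, fun h he => ?_, fun h ho => ?_, fun h => ?_⟩
  · rw [hr_small h, hR_even he] at hset
    have H : RegionParams d k 0 k :=
      ⟨hd', hk', le_rfl, by linarith, le_rfl, by linarith, by linarith⟩
    rw [hset, vtxB_eq_hypPoint k hd (u := k) (by linarith), vtxD_eq_hypPoint, hA, hC]
    refine ⟨H.mem_iff_of_zero_of_top, Set.Subset.antisymm (fun z hz => ?_)
      H.vertices_subset_extremePoints, ?_⟩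
    · exact (H.extremePoints_cases hz).resolve_right (by simp)
    · rw [H.frontier_eq, H.upperArc_eq_segment rfl, H.lowerArc_eq_segment rfl]
  · rw [hr_small h, hR_odd ho] at hset
    have hk3 : (3 : ℝ) ≤ k := by
      obtain ⟨n, rfl⟩ := ho
      exact_mod_cast (by omega : 3 ≤ 2 * n + 1)
    have H : RegionParams d k 0 ((k : ℝ) - 1) :=
      ⟨hd', hk', le_rfl, by linarith, by linarith, by linarith, by linarith⟩
    refine ⟨?_, isHyperbola_fCurve (by omega) hmul (by linarith) (by linarith), _, arc₁, ?_⟩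
    · rw [hset]
      exact H.mem_iff_of_zero
    rw [hset, vtxB_eq_hypPoint k hd (u := (k : ℝ) - 1) (by linarith), vtxD_eq_hypPoint, hA, hC]
    refine ⟨Set.Subset.antisymm (fun z hz => ?_) (Set.union_subset
      H.vertices_subset_extremePoints (H.upperArc_subset_extremePoints (by linarith))), ?_⟩
    · rcases H.extremePoints_cases hz with h | h | h
      · exact Or.inl h
      · exact Or.inr h.2
      · exact absurd h.1 (lt_irrefl _)
    · rw [H.frontier_eq, H.lowerArc_eq_segment rfl]
  · rw [hr_large h, hR_even he] at hset
    have h' : (d : ℝ) < 2 * k := by exact_mod_cast h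
    have H : RegionParams d k (2 * (k : ℝ) - d) k :=
      ⟨hd', hk', by linarith, by linarith, le_rfl, by linarith, by linarith⟩
    refine ⟨?_, isHyperbola_fCurve (by omega) hmul (by linarith) (by linarith), _,
      arc₂.resolve_right (by omega), ?_⟩
    · rw [hset]
      exact H.mem_iff_of_top
    rw [hset, vtxB_eq_hypPoint k hd (u := k) (by linarith), vtxE_eq_hypPoint d k, hA, hC]
    refine ⟨Set.Subset.antisymm (fun z hz => ?_) (Set.union_subset
      H.vertices_subset_extremePoints (H.lowerArc_subset_extremePoints (by linarith))), ?_⟩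
    · rcases H.extremePoints_cases hz with h | h | h
      · exact Or.inl h
      · exact absurd h.1 (lt_irrefl _)
      · exact Or.inr h.2
    · rw [H.frontier_eq, H.upperArc_eq_segment rfl]
  · rw [hr_large h, hR_odd ho] at hset
    have h' : (d : ℝ) < 2 * k := by exact_mod_cast h
    have hk3 : (3 : ℝ) ≤ k := by
      obtain ⟨n, rfl⟩ := ho
      exact_mod_cast (by omega : 3 ≤ 2 * n + 1)
    have H : RegionParams d k (2 * (k : ℝ) - d) ((k : ℝ) - 1) :=
      ⟨hd', hk', by linarith, by linarith, by linarith, by linarith, by linarith⟩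
    refine ⟨?_, isHyperbola_fCurve (by omega) hmul (by linarith) (by linarith),
      isHyperbola_fCurve (by omega) hmul (by linarith) (by linarith), _, _, arc₁,
      arc₂.resolve_right (by omega), ?_⟩
    · rw [hset]
      exact H.mem_iff_of_pos
    rw [hset, vtxB_eq_hypPoint k hd (u := (k : ℝ) - 1) (by linarith), vtxE_eq_hypPoint d k, hA, hC]
    refine ⟨Set.Subset.antisymm (fun z hz => ?_) (Set.union_subset (Set.union_subset
      H.vertices_subset_extremePoints (H.upperArc_subset_extremePoints (by linarith)))
      (H.lowerArc_subset_extremePoints (by linarith))), H.frontier_eq⟩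
    rcases H.extremePoints_cases hz with h | h | h
    · exact Or.inl (Or.inl h)
    · exact Or.inl (Or.inr h.2)
    · exact Or.inr h.2
  · constructor
    · intro heq
      have := fCurve_injective (by omega) hmul heq
      have : (k : ℝ) + 1 = d := by linarith
      exact_mod_cast this
    · rintro rfl
      congr 1
      push_cast
      ring
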